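/- Let $L_1(\mathbb{R})$ be the complex $L_1$ space, and write $\hat f(k)=\int_{-\infty}^\infty e^{ikx}f(x)\,dx$ for $f\in L_1(\mathbb{R})$. A measurable function $\psi:\mathbb{R}\to\mathbb{C}$ is called an $L_1$-multiplier if for every $f\in L_1(\mathbb{R})$ there is $v\in L_1(\mathbb{R})$ with $\psi\hat f=\hat v$; then $T_\psi f:=v$ defines a bounded operator $T_\psi$ on $L_1(\mathbb{R})$. Let $\alpha>0$ and let $p\ge 0$ be an integer with $2p-1<\alpha<2p+1$. For $h>0$ let $$\psi_h(k)=(-1)^{p+1}h^{-\alpha}e^{-ipkh}\left(1-e^{ikh}\right)^\alpha,\qquad k\in\mathbb{R},$$ with the principal branch of the power. Then the following hold. (a) For all $h>0$ and $t\ge 0$ the functions $\psi_h$ and $e^{t\psi_h}$ are $L_1$-multipliers, and $\{T_{e^{t\psi_h}}\}_{t\ge 0}$ is a strongly continuous semigroup on $L_1(\mathbb{R})$ with generator $T_{\psi_h}$. These semigroups are bounded uniformly in $h$ and $t$: there is $K$ such that $\|T_{e^{t\psi_h}}\|_{\mathcal{B}(L_1(\mathbb{R}))}\le K$ for all $h>0$,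 $t\ge 0$. If $1<\alpha<2$, then, for every $h>0$, $\{T_{e^{t\psi_h}}\}_{t\ge 0}$ is a semigroup of positive contractions on $L_1(\mathbb{R})$. If $0<\alpha<1$, then, for every $h>0$, the operators $T_{e^{t\psi_h}}$, $t\ge0$, map $L_1(\mathbb{R}_+)$ (regarded as a subspace of $L_1(\mathbb{R})$ through extension by zero) into itself, and their restrictions form a strongly continuous semigroup of positive contractions on $L_1(\mathbb{R}_+)$. (b) The semigroups $\{T_{e^{t\psi_h}}\}_{t\ge 0}$ are analytic uniformly in $h>0$ in the following sense: for all $h,t>0$ the function $\psi_h e^{t\psi_h}$ is an $L_1$-multiplier, and there is $M>0$ such that $\|T_{\psi_h e^{t\psi_h}}\|_{\mathcal{B}(L_1(\mathbb{R}))}\le M t^{-1}$ for all $t,h>0$. -/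

import Mathlib

noncomputable section

namespace Grunwald

open MeasureTheory Filter Topology FourierTransform

/-- The complex space `L₁(Ω, μ)`. -/
abbrev L1 {Ω : Type*} [MeasurableSpace Ω] (μ : Measure Ω) : Type _ := Lp ℂ 1 μ

/-- The space `L₁(ℝ)`. -/
abbrev L1R : Type := L1 (volume : Measure ℝ)

/-- The space `L₁(ℝ₊)`, where `ℝ₊ = [0, ∞)` carries Lebesgue measure. -/
abbrev L1Plus : Type := L1 ((volume : Measure ℝ).restrict (Set.Ici 0))

/-- The Fourier transform `f̂(k) = ∫ e^{ikx} f(x) dx` of `f ∈ L₁(ℝ)`. -/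
def fourierL1 (f : L1R) (k : ℝ) : ℂ :=
  ∫ x : ℝ, Complex.exp (Complex.I * k * x) * f x

/-- `ψ : ℝ → ℂ` is an `L₁`-multiplier: it is measurable and for every `f ∈ L₁(ℝ)` there is
`v ∈ L₁(ℝ)` such that `ψ f̂ = v̂`. -/
def IsL1Multiplier (ψ : ℝ → ℂ) : Prop :=
  Measurable ψ ∧ ∀ f : L1R, ∃ v : L1R, ∀ k : ℝ, ψ k * fourierL1 f k = fourierL1 v k

/-! ### Uniqueness of Fourier transforms, and the operator `T_ψ` -/

theorem integrable_fourierL1 (f : L1R) (k : ℝ) :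
    Integrable (fun x : ℝ => Complex.exp (Complex.I * k * x) * f x) := by
  refine (L1.integrable_coeFn f).bdd_mul (c := 1) ?_ ?_
  · exact Continuous.aestronglyMeasurable (by fun_prop)
  · refine Eventually.of_forall fun x => ?_
    have : Complex.I * (k : ℂ) * (x : ℂ) = ((k * x : ℝ) : ℂ) * Complex.I := by
      push_cast; ring
    rw [this, Complex.norm_exp_ofReal_mul_I]

theorem fourierL1_add (f g : L1R) (k : ℝ) :
    fourierL1 (f + g) k = fourierL1 f k + fourierL1 g k := by
  unfold fourierL1
  rw [← integral_add (integrable_fourierL1 f k) (integrable_fourierL1 g k)]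
  refine integral_congr_ae ?_
  filter_upwards [Lp.coeFn_add f g] with x hx
  rw [hx, Pi.add_apply, mul_add]

theorem fourierL1_smul (c : ℂ) (f : L1R) (k : ℝ) :
    fourierL1 (c • f) k = c * fourierL1 f k := by
  unfold fourierL1
  rw [← integral_const_mul]
  refine integral_congr_ae ?_
  filter_upwards [Lp.coeFn_smul c f] with x hx
  rw [hx, Pi.smul_apply, smul_eq_mul]
  ring

theorem norm_fourierL1_le (f : L1R) (k : ℝ) : ‖fourierL1 f k‖ ≤ ‖f‖ := by
  rw [L1.norm_eq_integral_norm]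
  refine (norm_integral_le_integral_norm _).trans (le_of_eq (integral_congr_ae ?_))
  refine Eventually.of_forall fun x => ?_
  have : Complex.I * (k : ℂ) * (x : ℂ) = ((k * x : ℝ) : ℂ) * Complex.I := by
    push_cast; ring
  simp only [norm_mul]
  rw [this, Complex.norm_exp_ofReal_mul_I, one_mul]

theorem fourierL1_sub (f g : L1R) (k : ℝ) :
    fourierL1 (f - g) k = fourierL1 f k - fourierL1 g k := by
  have h : f - g = f + (-1 : ℂ) • g := by simp [sub_eq_add_neg]
  rw [h, fourierL1_add, fourierL1_smul]
  ring

theorem continuous_fourierL1 (k : ℝ) : Continuous fun f : L1R => fourierL1 f k := by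
  refine LipschitzWith.continuous (K := 1) (LipschitzWith.of_dist_le_mul fun f g => ?_)
  rw [dist_eq_norm, dist_eq_norm, ← fourierL1_sub]
  simpa using norm_fourierL1_le (f - g) k

theorem fourier_eq_fourierL1 (f : L1R) (w : ℝ) :
    𝓕 (fun x : ℝ => f x) w = fourierL1 f (-2 * Real.pi * w) := by
  rw [Real.fourier_eq']
  unfold fourierL1
  refine integral_congr_ae (Eventually.of_forall fun x => ?_)
  simp only [smul_eq_mul]
  congr 2
  simp
  ring

/-- Uniqueness of Fourier transforms on `L₁(ℝ)`. -/
theorem fourierL1_injective {f g : L1R} (hfg : ∀ k, fourierL1 f k = fourierL1 g k) : f = g := by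
  rw [← sub_eq_zero]
  set d : L1R := f - g with hd
  have hz : ∀ k, fourierL1 d k = 0 := fun k => by rw [hd, fourierL1_sub, hfg, sub_self]
  rw [Lp.eq_zero_iff_ae_eq_zero]
  have hint : Integrable (fun x : ℝ => d x) := L1.integrable_coeFn d
  refine ae_eq_zero_of_integral_contDiff_smul_eq_zero hint.locallyIntegrable ?_
  intro u hu hc
  have hc' : HasCompactSupport (Complex.ofRealCLM ∘ u) := hc.comp_left rfl
  have hu' : ContDiff ℝ (⊤ : ℕ∞) (Complex.ofRealCLM ∘ u) := by fun_prop
  set φ : SchwartzMap ℝ ℂ := hc'.toSchwartzMap hu' with hφ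
  have key := VectorFourier.integral_fourierIntegral_smul_eq_flip (L := innerₗ ℝ)
    (μ := volume) (ν := volume) (f := fun x => (𝓕⁻ φ) x) (g := fun x : ℝ => d x)
    Real.continuous_fourierChar continuous_inner (𝓕⁻ φ).integrable hint
  have h1 : ∀ ξ, VectorFourier.fourierIntegral Real.fourierChar volume (innerₗ ℝ)
      (fun x => (𝓕⁻ φ) x) ξ = ((u ξ : ℝ) : ℂ) := by
    intro ξ
    have : VectorFourier.fourierIntegral Real.fourierChar volume (innerₗ ℝ)
      (fun x => (𝓕⁻ φ) x) ξ = (𝓕 (𝓕⁻ φ)) ξ := rfl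
    rw [this, FourierTransform.fourier_fourierInv_eq]
    rfl
  have h2 : ∀ x, VectorFourier.fourierIntegral Real.fourierChar volume (innerₗ ℝ).flip
      (fun x : ℝ => d x) x = 0 := by
    intro x
    rw [flip_innerₗ]
    exact (fourier_eq_fourierL1 d x).trans (hz _)
  simp only [h1, h2, smul_zero, integral_zero] at key
  simpa using key

theorem IsL1Multiplier.exists_clm {ψ : ℝ → ℂ} (hψ : IsL1Multiplier ψ) :
    ∃ T : L1R →L[ℂ] L1R, ∀ f k, fourierL1 (T f) k = ψ k * fourierL1 f k := by
  choose T hT using hψ.2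
  let A : L1R →ₗ[ℂ] L1R :=
    { toFun := T
      map_add' := fun f g => fourierL1_injective fun k => by
        rw [← hT, fourierL1_add, fourierL1_add, ← hT, ← hT, mul_add]
      map_smul' := fun c f => fourierL1_injective fun k => by
        rw [← hT, fourierL1_smul, RingHom.id_apply, fourierL1_smul, ← hT]
        ring }
  refine ⟨ContinuousLinearMap.ofSeqClosedGraph (g := A) ?_, fun f k => (hT f k).symm⟩
  intro u x y hu hAu
  refine fourierL1_injective fun k => ?_
  have e1 := ((continuous_fourierL1 k).tendsto y).comp hAu
  have e2 : Tendsto (fun n => ψ k * fourierL1 (u n) k) atTop (𝓝 (ψ k * fourierL1 x k)) :=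
    (((continuous_fourierL1 k).tendsto x).comp hu).const_mul _
  have e3 : (fun n => ψ k * fourierL1 (u n) k) = (fun f => fourierL1 f k) ∘ A ∘ u := by
    funext n
    exact hT (u n) k
  rw [e3] at e2
  rw [tendsto_nhds_unique e1 e2]
  exact hT x k

open Classical in
/-- The bounded operator `T_ψ` on `L₁(ℝ)` of an `L₁`-multiplier `ψ`: `T_ψ f` is the `v ∈ L₁(ℝ)`
with `v̂ = ψ f̂`. (It is `0` by convention if `ψ` is not an `L₁`-multiplier.) -/
def multiplierOp (ψ : ℝ → ℂ) : L1R →L[ℂ] L1R :=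
  if hψ : IsL1Multiplier ψ then hψ.exists_clm.choose else 0

theorem fourierL1_multiplierOp {ψ : ℝ → ℂ} (hψ : IsL1Multiplier ψ) (f : L1R) (k : ℝ) :
    fourierL1 (multiplierOp ψ f) k = ψ k * fourierL1 f k := by
  rw [multiplierOp, dif_pos hψ]
  exact hψ.exists_clm.choose_spec f k

/-! ### Semigroups on `L₁` -/

section Semigroup

variable {Ω : Type*} [MeasurableSpace Ω] {μ : Measure Ω}

/-- `{T t}_{t ≥ 0}` is a strongly continuous semigroup of bounded operators on `L₁(Ω, μ)`
(the values at negative times are irrelevant). -/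
structure IsC0Semigroup (T : ℝ → L1 μ →L[ℂ] L1 μ) : Prop where
  zero : T 0 = ContinuousLinearMap.id ℂ (L1 μ)
  add : ∀ s t : ℝ, 0 ≤ s → 0 ≤ t → T (s + t) = (T s).comp (T t)
  tendsto : ∀ f : L1 μ, Tendsto (fun t => T t f) (𝓝[>] 0) (𝓝 f)

/-- The bounded operator `A` is the generator of the semigroup `{T t}_{t ≥ 0}`. -/
def IsBoundedGenerator (A : L1 μ →L[ℂ] L1 μ) (T : ℝ → L1 μ →L[ℂ] L1 μ) : Prop :=
  ∀ f : L1 μ, Tendsto (fun t : ℝ => ((t⁻¹ : ℝ) : ℂ) • (T t f - f)) (𝓝[>] 0) (𝓝 (A f))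

/-- `f ∈ L₁(Ω, μ)` is real and nonnegative almost everywhere. -/
def IsNonneg (f : L1 μ) : Prop := ∀ᵐ x ∂μ, 0 ≤ (f x).re ∧ (f x).im = 0

/-- `A` is a positive operator on `L₁(Ω, μ)`. -/
def IsPositiveOp (A : L1 μ →L[ℂ] L1 μ) : Prop := ∀ f : L1 μ, IsNonneg f → IsNonneg (A f)

end Semigroup

/-- Extension by zero, `L₁(ℝ₊) → L₁(ℝ)`. -/
def extendByZero (f : L1Plus) : L1R :=
  ((memLp_indicator_iff_restrict (measurableSet_Ici (a := (0 : ℝ)))).2 (Lp.memLp f)).toLp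
    (Set.indicator (Set.Ici (0 : ℝ)) f)

/-- The symbol `ψ_h(k) = (-1)^{p+1} h^{-α} e^{-ipkh} (1 - e^{ikh})^α` of the `p`-shifted Grünwald
formula (principal branch of the power). -/
def symbol (α : ℝ) (p : ℕ) (h k : ℝ) : ℂ :=
  (-1) ^ (p + 1) * ((h ^ (-α) : ℝ) : ℂ) * Complex.exp (-(Complex.I * p * k * h)) *
    (1 - Complex.exp (Complex.I * k * h)) ^ (α : ℂ)

/-- The family `T_{e^{tψ_h}}`, `t ∈ ℝ`. -/
def semigroup (α : ℝ) (p : ℕ) (h t : ℝ) : L1R →L[ℂ] L1R :=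
  multiplierOp fun k => Complex.exp (t * symbol α p h k)

end Grunwald

end

noncomputable section

namespace Grunwald

open MeasureTheory Filter Topology

section

/-! ### Operators with a symbol -/

/-! For `α > 0` the binomial series of `(1 - z)^α` converges absolutely on the closed unit disc.
Hence `ψ_h` is the symbol of a norm-convergent weighted sum `B` of translations (`grunwaldOp`), and
since Fourier transforms determine operators, `T_{e^{tψ_h}} = exp(tB)`. The semigroup and generator
claims are then those of a bounded operator; the content lies in the uniform bounds.

Positivity and contractivity come from signs. The coefficients of `B` sum to `0`, so if only the one
multiplying the identity is negative, then `B = P - b` with `P` positive and `‖P‖ ≤ b`, and `exp(tB)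
= e^{-tb} exp(tP)`. This covers `p = 0`, `α ≤ 1` and `p = 1`, `1 < α < 2`.

For the uniform bounds write `tψ_h(k) = τ g(kh)` with `τ = t h^{-α}` and `g` of period `2π`. A
Fourier series `∑ aₙ e^{inx}` evaluated at `x = kh` is the symbol of `∑ aₙ` times translation by
`nh`, so `∑ |aₙ|` bounds the operator norm and only `τ` matters. Small `τ` is trivial. For `τ ≥ 1`,
the condition on `p` puts `-g` in a sector strictly inside the right half plane, so `e^{τg}` decays
like `exp(-c |lx|^α)` with `l = τ^{1/α}`. The quantity `l ‖F‖² + l⁻¹ ‖F'‖²` (norms in `L₂`) is then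
bounded in `l` and controls `∑ |aₙ|` (`exists_fourier_hasSum`, `exists_fourier_bound`). As `|F'|²`
behaves like `x^{2α-2}` at `0`, this needs `α > 1/2`.

For `α ≤ 1/2` one has `p = 0`, and boundedness is contractivity. For analyticity, `v e^{-v}` is an
integral of `e^{-v²/(4x²)}` against a signed integrable density (`integral_subordinator`). With `v =
-tψ_h`, `v²` is `-t²` times the symbol of order `2α ≤ 1`, whose semigroup is contractive. -/

/-- The operator `T` on `L₁(ℝ)` acts on Fourier transforms as multiplication by `ψ`. -/
def HasSymbol (T : L1R →L[ℂ] L1R) (ψ : ℝ → ℂ) : Prop :=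
  ∀ f k, fourierL1 (T f) k = ψ k * fourierL1 f k

/-- The value of the Fourier transform at `k`, as a continuous linear functional. -/
def fourierL1CLM (k : ℝ) : L1R →L[ℂ] ℂ :=
  { toFun := fun f => fourierL1 f k
    map_add' := fun f g => fourierL1_add f g k
    map_smul' := fun c f => by simpa using fourierL1_smul c f k
    cont := continuous_fourierL1 k }

/-- `T ↦ (T f)^(k)` as a continuous linear functional on the bounded operators. -/
def fourierApply (f : L1R) (k : ℝ) : (L1R →L[ℂ] L1R) →L[ℂ] ℂ :=
  (fourierL1CLM k).comp (ContinuousLinearMap.apply ℂ L1R f)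

theorem fourierApply_apply (f : L1R) (k : ℝ) (T : L1R →L[ℂ] L1R) :
    fourierApply f k T = fourierL1 (T f) k := rfl

theorem multiplierOp_hasSymbol {ψ : ℝ → ℂ} (hψ : IsL1Multiplier ψ) :
    HasSymbol (multiplierOp ψ) ψ :=
  fun f k => fourierL1_multiplierOp hψ f k

namespace HasSymbol

variable {S T : L1R →L[ℂ] L1R} {φ ψ : ℝ → ℂ}

theorem isL1Multiplier (hT : HasSymbol T ψ) (hψ : Measurable ψ) : IsL1Multiplier ψ :=
  ⟨hψ, fun f => ⟨T f, fun k => (hT f k).symm⟩⟩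

/-- This turns identities of scalar symbols into identities of operators; every norm bound below is
obtained by finding a second representation with the same symbol. -/
theorem unique (hS : HasSymbol S ψ) (hT : HasSymbol T ψ) : S = T := by
  ext1 f
  exact fourierL1_injective fun k => by rw [hS, hT]

theorem multiplierOp_eq (hT : HasSymbol T ψ) (hψ : Measurable ψ) : multiplierOp ψ = T :=
  (multiplierOp_hasSymbol (hT.isL1Multiplier hψ)).unique hT

theorem congr (hT : HasSymbol T φ) (h : ∀ k, φ k = ψ k) : HasSymbol T ψ :=
  fun f k => by rw [hT, h]

theorem one : HasSymbol 1 fun _ => 1 := fun f k => by simp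

theorem smul (hT : HasSymbol T ψ) (c : ℂ) : HasSymbol (c • T) fun k => c * ψ k := fun f k => by
  rw [smul_apply, fourierL1_smul, hT, mul_assoc]

theorem mul (hS : HasSymbol S φ) (hT : HasSymbol T ψ) : HasSymbol (S * T) fun k => φ k * ψ k :=
  fun f k => by
    rw [mul_apply_eq_comp, hS, hT, mul_assoc]

theorem pow (hT : HasSymbol T ψ) (n : ℕ) : HasSymbol (T ^ n) fun k => ψ k ^ n := by
  induction n with
  | zero => simpa using one
  | succ n ih => simpa only [pow_succ] using ih.mul hT

theorem hasSum {ι : Type*} {F : ι → L1R →L[ℂ] L1R} {Φ : ι → ℝ → ℂ} (hF : ∀ i, HasSymbol (F i) (Φ i))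
    (hT : HasSum F T) (hψ : ∀ k, HasSum (fun i => Φ i k) (ψ k)) : HasSymbol T ψ := fun f k => by
  have h := (fourierApply f k).hasSum hT
  simp only [fourierApply_apply, (hF _ f k)] at h
  exact h.unique ((hψ k).mul_right _)

theorem exp (hT : HasSymbol T ψ) :
    HasSymbol (NormedSpace.exp T) fun k => Complex.exp (ψ k) := by
  refine hasSum (fun n => (hT.pow n).smul ((n.factorial : ℂ)⁻¹))
    (NormedSpace.exp_series_hasSum_exp' (𝕂 := ℂ) T) fun k => ?_
  rw [Complex.exp_eq_exp_ℂ]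
  exact NormedSpace.exp_series_hasSum_exp' (𝕂 := ℂ) (ψ k)

theorem integral {X : Type*} [MeasurableSpace X] {μ : Measure X} {F : X → L1R →L[ℂ] L1R}
    {Φ : X → ℝ → ℂ} (hF : ∀ x, HasSymbol (F x) (Φ x)) (hint : Integrable F μ) :
    HasSymbol (∫ x, F x ∂μ) fun k => ∫ x, Φ x k ∂μ := fun f k => by
  rw [← fourierApply_apply, ← ContinuousLinearMap.integral_comp_comm _ hint]
  simp only [fourierApply_apply, (hF _ f k), integral_mul_const]

end HasSymbol

/-! ### Translations -/

/-- Translation `f ↦ f(· - y)` on `L₁(ℝ)`. -/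
def translation (y : ℝ) : L1R →ₗᵢ[ℂ] L1R :=
  Lp.compMeasurePreservingₗᵢ ℂ (fun x => x - y) (measurePreserving_sub_right volume y)

theorem coeFn_translation (y : ℝ) (f : L1R) : translation y f =ᵐ[volume] fun x => f (x - y) :=
  Lp.coeFn_compMeasurePreserving f (measurePreserving_sub_right volume y)

theorem hasSymbol_translation (y : ℝ) :
    HasSymbol (translation y).toContinuousLinearMap fun k => Complex.exp (Complex.I * k * y) :=
  fun f k => by
  have h : fourierL1 (translation y f) k =
      ∫ x : ℝ, Complex.exp (Complex.I * k * x) * f (x - y) :=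
    integral_congr_ae <| (coeFn_translation y f).mono fun x hx => by simp only [hx]
  change fourierL1 (translation y f) k = _
  rw [h, ← integral_add_right_eq_self _ y]
  unfold fourierL1
  rw [← integral_const_mul]
  congr 1
  ext x
  rw [add_sub_cancel_right, ← mul_assoc, ← Complex.exp_add]
  congr 2
  push_cast
  ring

theorem norm_translation_le (y : ℝ) : ‖(translation y).toContinuousLinearMap‖ ≤ 1 :=
  (translation y).norm_toContinuousLinearMap_le

/-- The operator `∑ cᵢ T_{yᵢ}`, a weighted sum of translations. -/
def translationSeries {ι : Type*} (c : ι → ℂ) (y : ι → ℝ) : L1R →L[ℂ] L1R :=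
  ∑' i, c i • (translation (y i)).toContinuousLinearMap

section translationSeries

variable {ι : Type*} {c : ι → ℂ} {y : ι → ℝ}

theorem norm_smul_translation_le (c : ℂ) (y : ℝ) :
    ‖c • (translation y).toContinuousLinearMap‖ ≤ ‖c‖ := by
  rw [norm_smul]
  exact mul_le_of_le_one_right (norm_nonneg _) (norm_translation_le y)

theorem summable_translationSeries (hc : Summable fun i => ‖c i‖) (y : ι → ℝ) :
    Summable fun i => c i • (translation (y i)).toContinuousLinearMap :=
  Summable.of_norm_bounded hc fun _ => norm_smul_translation_le _ _

theorem norm_translationSeries_le (hc : Summable fun i => ‖c i‖) :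
    ‖translationSeries c y‖ ≤ ∑' i, ‖c i‖ :=
  tsum_of_norm_bounded hc.hasSum fun _ => norm_smul_translation_le _ _

theorem hasSymbol_translationSeries (hc : Summable fun i => ‖c i‖) {ψ : ℝ → ℂ}
    (hψ : ∀ k : ℝ, HasSum (fun i => c i * Complex.exp (Complex.I * k * y i)) (ψ k)) :
    HasSymbol (translationSeries c y) ψ :=
  HasSymbol.hasSum (fun i => (hasSymbol_translation (y i)).smul (c i))
    (summable_translationSeries hc y).hasSum hψ

end translationSeries

/-! ### The semigroup generated by a bounded operator -/

theorem hasSymbol_exp_smul {B : L1R →L[ℂ] L1R} {ψ : ℝ → ℂ} (hB : HasSymbol B ψ) (t : ℝ) :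
    HasSymbol (NormedSpace.exp ((t : ℂ) • B)) fun k => Complex.exp (t * ψ k) :=
  (hB.smul (t : ℂ)).exp

/-- Since `B` is bounded, the exponential is differentiable at `0` in operator norm, which is
stronger than the strong limit required. -/
theorem isBoundedGenerator_exp {Ω : Type*} [MeasurableSpace Ω] {μ : Measure Ω}
    (B : L1 μ →L[ℂ] L1 μ) :
    IsBoundedGenerator B fun t => NormedSpace.exp ((t : ℂ) • B) := by
  intro f
  have h : HasDerivAt (fun t : ℝ => NormedSpace.exp ((t : ℂ) • B)) B 0 := by
    have h0 := hasDerivAt_exp_smul_const (𝕂 := ℂ) B ((0 : ℝ) : ℂ)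
    have h1 := h0.scomp (0 : ℝ) Complex.ofRealCLM.hasDerivAt
    simp only [Complex.ofRealCLM_apply, Complex.ofReal_zero, Complex.ofReal_one, zero_smul,
      NormedSpace.exp_zero, one_mul, one_smul] at h1
    exact h1
  have h1 := (hasDerivAt_iff_tendsto_slope_zero.1 h).mono_left
    (nhdsWithin_mono 0 (show Set.Ioi (0 : ℝ) ⊆ {0}ᶜ from fun x hx => ne_of_gt hx))
  have h2 := ((ContinuousLinearMap.apply ℂ (L1 μ) f).continuous.tendsto B).comp h1
  refine h2.congr fun t => ?_
  simp only [Function.comp_apply, zero_add, Complex.ofReal_zero, zero_smul ℂ B,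
    NormedSpace.exp_zero, Complex.coe_smul]
  rfl

theorem isC0Semigroup_exp {Ω : Type*} [MeasurableSpace Ω] {μ : Measure Ω}
    (B : L1 μ →L[ℂ] L1 μ) :
    IsC0Semigroup fun t => NormedSpace.exp ((t : ℂ) • B) where
  zero := by simp; rfl
  add s t _ _ := by
    let _ : NormedAlgebra ℚ (L1 μ →L[ℂ] L1 μ) := NormedAlgebra.restrictScalars ℚ ℂ _
    rw [Complex.ofReal_add, add_smul, NormedSpace.exp_add_of_commute]
    · rfl
    · exact ((Commute.refl B).smul_left _).smul_right _
  tendsto f := by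
    have h : Continuous fun t : ℝ => NormedSpace.exp ((t : ℂ) • B) f := by
      let _ : NormedAlgebra ℚ (L1 μ →L[ℂ] L1 μ) := NormedAlgebra.restrictScalars ℚ ℂ _
      have := NormedSpace.exp_continuous (𝔸 := L1 μ →L[ℂ] L1 μ)
      fun_prop
    have := (h.tendsto 0).mono_left (nhdsWithin_le_nhds (s := Set.Ioi 0))
    simpa using this

end

section

/-! ### The Grünwald coefficients -/

/-- The coefficients `(-1)^m (α choose m)` of the power series of `(1 - z)^α`. -/
def coeff (α : ℝ) (m : ℕ) : ℝ := (-1) ^ m * Ring.choose α m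

theorem coeff_zero (α : ℝ) : coeff α 0 = 1 := by simp [coeff]

/-- All sign information comes from this recursion: the factor `m - α` is nonnegative once `m ≥ α`.
-/
theorem coeff_succ (α : ℝ) (m : ℕ) : (m + 1) * coeff α (m + 1) = (m - α) * coeff α m := by
  have h : ((m : ℝ) + 1) * Ring.choose α (m + 1) = (α - m) * Ring.choose α m := by
    simp only [Ring.choose_eq_smul, descPochhammer_succ_right, Polynomial.smeval_mul,
      Polynomial.smeval_sub, Polynomial.smeval_X, Polynomial.smeval_natCast, Nat.factorial_succ,
      smul_eq_mul]
    push_cast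
    field_simp
    simp
  unfold coeff
  rw [pow_succ]
  linear_combination (-(-1) ^ m) * h

theorem coeff_one (α : ℝ) : coeff α 1 = -α := by
  have := coeff_succ α 0
  simp [coeff_zero] at this
  linarith

/-- From the index `N ≥ α` on, the coefficients do not change sign. -/
theorem mul_coeff_nonneg {α s : ℝ} {N : ℕ} (hN : α ≤ N) (h : 0 ≤ s * coeff α N) {m : ℕ}
    (hm : N ≤ m) : 0 ≤ s * coeff α m := by
  induction m, hm using Nat.le_induction with
  | base => exact h
  | succ m hm ih =>
    have h1 := coeff_succ α m
    have h2 : (N : ℝ) ≤ m := by exact_mod_cast hm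
    have h3 : (0 : ℝ) < m + 1 := by positivity
    have h4 : s * coeff α (m + 1) = (m - α) * (s * coeff α m) / (m + 1) := by
      field_simp
      linear_combination s * h1
    rw [h4]
    exact div_nonneg (mul_nonneg (by linarith) ih) h3.le

theorem hasSum_coeff_of_norm_lt_one (α : ℝ) {z : ℂ} (hz : ‖z‖ < 1) :
    HasSum (fun m => (coeff α m : ℂ) * z ^ m) ((1 - z) ^ (α : ℂ)) := by
  have h := Complex.one_add_cpow_hasFPowerSeriesOnBall_zero (a := (α : ℂ))
  have h2 := h.hasSum (y := -z)
    (by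
      rw [Metric.mem_eball, edist_zero_right, enorm_neg, ← ofReal_norm, ENNReal.ofReal_lt_one]
      exact hz)
  simp only [zero_add, binomialSeries_apply, List.ofFn_const, List.prod_replicate,
    smul_eq_mul] at h2
  convert! h2 using 2 with m
  rw [neg_pow z, coeff]
  push_cast
  ring

/-- The tail has constant sign, so it is enough to bound its partial sums. Weighted by `x^m` with `0
< x < 1`, they are at most `|(1 - x)^α|` plus the absolute initial sum, uniformly in `x`; then `x`
tends to `1`. -/
theorem summable_abs_coeff {α : ℝ} (hα : 0 < α) : Summable fun m => |coeff α m| := by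
  obtain ⟨N, hN⟩ := exists_nat_ge α
  obtain ⟨s, hs, hsN⟩ : ∃ s : ℝ, |s| = 1 ∧ 0 ≤ s * coeff α N := by
    rcases le_total 0 (coeff α N) with h | h
    · exact ⟨1, by simp, by simpa⟩
    · exact ⟨-1, by simp, by simpa⟩
  have hpos : ∀ m, 0 ≤ s * coeff α (m + N) := fun m => mul_coeff_nonneg hN hsN (by lia)
  have habs : ∀ m, s * coeff α (m + N) = |coeff α (m + N)| := fun m => by
    rw [← abs_of_nonneg (hpos m), abs_mul, hs, one_mul]
  rw [← summable_nat_add_iff N]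
  refine (summable_of_sum_range_le (c := 1 + ∑ m ∈ Finset.range N, |coeff α m|) hpos
    fun n => ?_).congr habs
  have key : ∀ x ∈ Set.Ioo (0 : ℝ) 1, ∑ m ∈ Finset.range n, s * coeff α (m + N) * x ^ (m + N) ≤
      1 + ∑ m ∈ Finset.range N, |coeff α m| := by
    intro x hx
    have h1 : HasSum (fun m => coeff α m * x ^ m) ((1 - x) ^ α) := by
      have := hasSum_coeff_of_norm_lt_one α (z := x)
        (by simpa [abs_lt] using ⟨by linarith [hx.1], hx.2⟩)
      rw [← Complex.hasSum_ofReal]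
      rw [Complex.ofReal_cpow (by linarith [hx.2])]
      simpa using this
    have h2 := ((hasSum_nat_add_iff' N).2 h1).mul_left s
    have h3 : ∑ m ∈ Finset.range n, s * coeff α (m + N) * x ^ (m + N) ≤
        s * ((1 - x) ^ α - ∑ m ∈ Finset.range N, coeff α m * x ^ m) := by
      refine (Finset.sum_le_sum fun m _ => (mul_assoc _ _ _).le).trans
        (sum_le_hasSum _ (fun m _ => ?_) h2)
      rw [← mul_assoc]
      exact mul_nonneg (hpos m) (pow_nonneg hx.1.le _)
    refine h3.trans ((le_abs_self _).trans ?_)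
    rw [abs_mul, hs, one_mul]
    refine (abs_sub _ _).trans (add_le_add ?_ ((Finset.abs_sum_le_sum_abs _ _).trans
      (Finset.sum_le_sum fun m _ => ?_)))
    · rw [abs_of_nonneg (Real.rpow_nonneg (by linarith [hx.2]) _)]
      exact Real.rpow_le_one (by linarith [hx.2]) (by linarith [hx.1]) hα.le
    · rw [abs_mul, abs_pow, abs_of_pos hx.1]
      exact mul_le_of_le_one_right (abs_nonneg _) (pow_le_one₀ hx.1.le hx.2.le)
  have hlim : Tendsto (fun x : ℝ => ∑ m ∈ Finset.range n, s * coeff α (m + N) * x ^ (m + N))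
      (𝓝[<] 1) (𝓝 (∑ m ∈ Finset.range n, s * coeff α (m + N))) := by
    have : Continuous fun x : ℝ => ∑ m ∈ Finset.range n, s * coeff α (m + N) * x ^ (m + N) := by
      fun_prop
    simpa using (this.tendsto 1).mono_left nhdsWithin_le_nhds
  exact le_of_tendsto hlim (by
    filter_upwards [Ioo_mem_nhdsLT (show (0 : ℝ) < 1 by norm_num)] with x hx using key x hx)

theorem re_one_sub_nonneg {z : ℂ} (hz : ‖z‖ ≤ 1) : 0 ≤ (1 - z).re := by
  have := (Complex.re_le_norm z).trans hz
  simpa using this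

/-- On the disc `1 - z` has nonnegative real part and so avoids the branch cut except at its end
`0`, where `α > 0` gives continuity. -/
theorem continuousOn_one_sub_cpow {α : ℝ} (hα : 0 < α) :
    ContinuousOn (fun z : ℂ => (1 - z) ^ (α : ℂ)) (Metric.closedBall 0 1) := fun z hz =>
  ((Complex.continuousAt_cpow_const_of_re_pos (Or.inl (re_one_sub_nonneg (by simpa using hz)))
    (by simpa using hα)).comp (f := fun z : ℂ => 1 - z) (by fun_prop)).continuousWithinAt

theorem summable_norm_coeff {α : ℝ} (hα : 0 < α) : Summable fun m => ‖(coeff α m : ℂ)‖ := by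
  simpa using summable_abs_coeff hα

/-- The binomial series on the closed unit disc. -/
theorem hasSum_coeff {α : ℝ} (hα : 0 < α) {z : ℂ} (hz : ‖z‖ ≤ 1) :
    HasSum (fun m => (coeff α m : ℂ) * z ^ m) ((1 - z) ^ (α : ℂ)) := by
  have hb : ∀ m, ∀ z ∈ Metric.closedBall (0 : ℂ) 1,
      ‖(coeff α m : ℂ) * z ^ m‖ ≤ ‖(coeff α m : ℂ)‖ := by
    intro m z hz
    rw [norm_mul, norm_pow]
    exact mul_le_of_le_one_right (norm_nonneg _)
      (pow_le_one₀ (norm_nonneg _) (by simpa using hz))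
  have hcont : ContinuousOn (fun z : ℂ => ∑' m, (coeff α m : ℂ) * z ^ m)
      (Metric.closedBall 0 1) :=
    continuousOn_tsum (fun m => by fun_prop) (summable_norm_coeff hα) hb
  have heq : Set.EqOn (fun z : ℂ => ∑' m, (coeff α m : ℂ) * z ^ m)
      (fun z => (1 - z) ^ (α : ℂ)) (Metric.closedBall 0 1) := by
    -- Both sides are continuous on the closed disc and agree on the open one.
    refine Set.EqOn.of_subset_closure (s := Metric.ball 0 1) (fun z hz => ?_) hcont
      (continuousOn_one_sub_cpow hα) Metric.ball_subset_closedBall ?_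
    · exact (hasSum_coeff_of_norm_lt_one α (by simpa using hz)).tsum_eq
    · rw [closure_ball _ one_ne_zero]
  have hz' : z ∈ Metric.closedBall (0 : ℂ) 1 := by simpa using hz
  have hsum : Summable fun m => (coeff α m : ℂ) * z ^ m :=
    Summable.of_norm_bounded (summable_norm_coeff hα) fun m => hb m z hz'
  rw [← show _ = (1 - z) ^ (α : ℂ) from heq hz']
  exact hsum.hasSum

theorem hasSum_coeff_one {α : ℝ} (hα : 0 < α) : HasSum (coeff α) 0 := by
  have h := hasSum_coeff hα (z := 1) (by simp)
  rw [← Complex.hasSum_ofReal]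
  have h0 : (α : ℂ) ≠ 0 := by exact_mod_cast hα.ne'
  simpa [Complex.zero_cpow h0] using h

theorem coeff_nonpos {β : ℝ} (h0 : 0 < β) (h1 : β ≤ 1) {m : ℕ} (hm : 1 ≤ m) : coeff β m ≤ 0 := by
  have := mul_coeff_nonneg (α := β) (s := -1) (N := 1) (by simpa) (by simp [coeff_one, h0.le]) hm
  linarith

/-- The recursion gives `2 c₂ = (1 - α)(-α) > 0`, and the sign persists because `α ≤ 2`. -/
theorem coeff_nonneg {α : ℝ} (h1 : 1 < α) (h2 : α < 2) {m : ℕ} (hm : 2 ≤ m) : 0 ≤ coeff α m := by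
  have h := coeff_succ α 1
  rw [coeff_one] at h
  norm_num at h
  have := mul_coeff_nonneg (α := α) (s := 1) (N := 2) (by simpa using h2.le) (by nlinarith) hm
  linarith

/-! ### The Grünwald operator -/

theorem measurable_symbol (α : ℝ) (p : ℕ) (h : ℝ) : Measurable (symbol α p h) := by
  unfold symbol
  fun_prop

/-- The coefficients of the symbol `ψ_h`. -/
def grunwaldCoeff (α : ℝ) (p : ℕ) (h : ℝ) (m : ℕ) : ℝ :=
  (-1) ^ (p + 1) * h ^ (-α) * coeff α m

/-- The `p`-shifted Grünwald formula, the operator with symbol `ψ_h`. -/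
def grunwaldOp (α : ℝ) (p : ℕ) (h : ℝ) : L1R →L[ℂ] L1R :=
  translationSeries (fun m : ℕ => (grunwaldCoeff α p h m : ℂ)) fun m => (m - p) * h

variable {α h : ℝ} {p : ℕ}

theorem summable_norm_grunwaldCoeff (hα : 0 < α) (p : ℕ) (h : ℝ) :
    Summable fun m => ‖(grunwaldCoeff α p h m : ℂ)‖ := by
  simp only [grunwaldCoeff, Complex.ofReal_mul, norm_mul]
  exact (summable_norm_coeff hα).mul_left _

theorem hasSymbol_grunwaldOp (hα : 0 < α) (p : ℕ) (h : ℝ) :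
    HasSymbol (grunwaldOp α p h) (symbol α p h) := by
  refine hasSymbol_translationSeries (summable_norm_grunwaldCoeff hα p h) fun k => ?_
  have hz : ‖Complex.exp (Complex.I * k * h)‖ ≤ 1 := by
    rw [show Complex.I * k * h = ((k * h : ℝ) : ℂ) * Complex.I by push_cast; ring,
      Complex.norm_exp_ofReal_mul_I]
  have := (hasSum_coeff hα hz).mul_left
    ((-1) ^ (p + 1) * ((h ^ (-α) : ℝ) : ℂ) * Complex.exp (-(Complex.I * p * k * h)))
  refine this.congr_fun fun m => ?_
  rw [← Complex.exp_nat_mul, grunwaldCoeff]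
  push_cast
  rw [show Complex.I * (k : ℂ) * ((m - p) * h) = -(Complex.I * p * k * h) +
    m * (Complex.I * k * h) by ring, Complex.exp_add]
  ring

theorem hasSymbol_exp_grunwaldOp (hα : 0 < α) (p : ℕ) (h t : ℝ) :
    HasSymbol (NormedSpace.exp ((t : ℂ) • grunwaldOp α p h))
      fun k => Complex.exp (t * symbol α p h k) :=
  hasSymbol_exp_smul (hasSymbol_grunwaldOp hα p h) t

theorem measurable_exp_symbol (α : ℝ) (p : ℕ) (h t : ℝ) :
    Measurable fun k => Complex.exp (t * symbol α p h k) :=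
  ((measurable_symbol α p h).const_mul _).cexp

theorem semigroup_eq_exp (hα : 0 < α) (p : ℕ) (h : ℝ) :
    semigroup α p h = fun t : ℝ => NormedSpace.exp ((t : ℂ) • grunwaldOp α p h) :=
  funext fun t => (hasSymbol_exp_grunwaldOp hα p h t).multiplierOp_eq
    (measurable_exp_symbol α p h t)

theorem multiplierOp_symbol (hα : 0 < α) (p : ℕ) (h : ℝ) :
    multiplierOp (symbol α p h) = grunwaldOp α p h :=
  (hasSymbol_grunwaldOp hα p h).multiplierOp_eq (measurable_symbol α p h)

end

section

/-! ### Nonnegative functions and positive operators -/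

section Positive

variable {Ω : Type*} [MeasurableSpace Ω] {μ : Measure Ω}

theorem IsNonneg.add {f g : L1 μ} (hf : IsNonneg f) (hg : IsNonneg g) : IsNonneg (f + g) := by
  filter_upwards [hf, hg, Lp.coeFn_add f g] with x h1 h2 h3
  rw [h3, Pi.add_apply, Complex.add_re, Complex.add_im]
  exact ⟨add_nonneg h1.1 h2.1, by rw [h1.2, h2.2, add_zero]⟩

theorem isNonneg_zero : IsNonneg (0 : L1 μ) := by
  filter_upwards [Lp.coeFn_zero ℂ 1 μ] with x hx
  rw [hx]
  exact ⟨le_rfl, rfl⟩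

theorem IsNonneg.smul {f : L1 μ} (hf : IsNonneg f) {c : ℝ} (hc : 0 ≤ c) :
    IsNonneg ((c : ℂ) • f) := by
  filter_upwards [hf, Lp.coeFn_smul (c : ℂ) f] with x h1 h2
  rw [h2, Pi.smul_apply, smul_eq_mul, Complex.re_ofReal_mul, Complex.im_ofReal_mul, h1.2, mul_zero]
  exact ⟨mul_nonneg hc h1.1, rfl⟩

/-- A property of integrable functions that holds almost everywhere and is closed pointwise
defines a closed subset of `L₁`. -/
theorem isClosed_setOf_ae_mem (s : Ω → Set ℂ) (hs : ∀ x, IsClosed (s x)) :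
    IsClosed {f : L1 μ | ∀ᵐ x ∂μ, f x ∈ s x} := by
  refine isSeqClosed_iff_isClosed.1 fun u f hu hf => ?_
  -- Convergence in `L₁` gives pointwise convergence only along a subsequence, which is enough here.
  obtain ⟨ns, -, hns⟩ := (tendstoInMeasure_of_tendsto_Lp hf).exists_seq_tendsto_ae
  filter_upwards [hns, ae_all_iff.2 hu] with x h1 h2
  exact (hs x).mem_of_tendsto h1 (Eventually.of_forall fun n => h2 (ns n))

theorem isClosed_isNonneg : IsClosed {f : L1 μ | IsNonneg f} :=
  isClosed_setOf_ae_mem (fun _ => {z : ℂ | 0 ≤ z.re ∧ z.im = 0}) fun _ =>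
    (isClosed_le continuous_const Complex.continuous_re).inter
      (isClosed_eq Complex.continuous_im continuous_const)

theorem isClosed_preserving {E : Type*} [NormedAddCommGroup E] [NormedSpace ℂ E] {s : Set E}
    (hs : IsClosed s) : IsClosed {A : E →L[ℂ] E | ∀ f ∈ s, A f ∈ s} := by
  simp only [Set.ofPred_forall]
  exact isClosed_biInter fun f _ => hs.preimage (by fun_prop)

theorem isClosed_isPositiveOp : IsClosed {A : L1 μ →L[ℂ] L1 μ | IsPositiveOp A} :=
  isClosed_preserving isClosed_isNonneg

end Positive

/-- A closed set that contains `0` and is stable under addition is stable under sums of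
series. -/
theorem mem_of_hasSum_of_forall {E ι : Type*} [AddCommMonoid E] [TopologicalSpace E]
    [ContinuousAdd E] {s : Set E} (hs : IsClosed s) (h0 : 0 ∈ s)
    (hadd : ∀ a ∈ s, ∀ b ∈ s, a + b ∈ s) {f : ι → E} {a : E} (hf : HasSum f a)
    (h : ∀ i, f i ∈ s) : a ∈ s :=
  hs.mem_of_tendsto hf (Eventually.of_forall fun _ =>
    Finset.sum_induction f (· ∈ s) (fun a b ha hb => hadd a ha b hb) h0 fun i _ => h i)

/-- A closed convex cone `s` mapped into itself by `P` is mapped into itself by `exp(tP)`,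
`t ≥ 0`. -/
theorem exp_smul_mem {E : Type*} [NormedAddCommGroup E] [NormedSpace ℂ E] [CompleteSpace E]
    {s : Set E} (hs : IsClosed s) (h0 : 0 ∈ s) (hadd : ∀ a ∈ s, ∀ b ∈ s, a + b ∈ s)
    (hsmul : ∀ c : ℝ, 0 ≤ c → ∀ a ∈ s, (c : ℂ) • a ∈ s) {P : E →L[ℂ] E}
    (hP : ∀ f ∈ s, P f ∈ s) {t : ℝ} (ht : 0 ≤ t) {f : E} (hf : f ∈ s) :
    NormedSpace.exp ((t : ℂ) • P) f ∈ s := by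
  have hsum := (ContinuousLinearMap.apply ℂ E f).hasSum
    (NormedSpace.exp_series_hasSum_exp' (𝕂 := ℂ) ((t : ℂ) • P))
  refine mem_of_hasSum_of_forall hs h0 hadd hsum fun n => ?_
  have hn : (P ^ n) f ∈ s := by
    induction n with
    | zero => simpa
    | succ n ih =>
      rw [pow_succ']
      exact hP _ ih
  have := hsmul ((n.factorial : ℝ)⁻¹ * t ^ n) (by positivity) _ hn
  convert this using 1
  rw [ContinuousLinearMap.apply_apply, smul_pow, smul_smul, smul_apply]
  push_cast
  rfl

theorem exp_smul_sub_smul_one {E : Type*} [NormedAddCommGroup E] [NormedSpace ℂ E]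
    [CompleteSpace E] (P : E →L[ℂ] E) (b t : ℝ) :
    NormedSpace.exp ((t : ℂ) • (P - (b : ℂ) • 1)) =
      ((Real.exp (-(t * b)) : ℝ) : ℂ) • NormedSpace.exp ((t : ℂ) • P) := by
  let _ : NormedAlgebra ℚ (E →L[ℂ] E) := NormedAlgebra.restrictScalars ℚ ℂ _
  have h1 : (t : ℂ) • (P - (b : ℂ) • (1 : E →L[ℂ] E)) =
      algebraMap ℂ (E →L[ℂ] E) (-(t * b)) + (t : ℂ) • P := by
    rw [Algebra.algebraMap_eq_smul_one, smul_sub, smul_smul]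
    module
  rw [h1, NormedSpace.exp_add_of_commute (Algebra.commutes _ _), ← NormedSpace.algebraMap_exp_comm,
    Algebra.algebraMap_eq_smul_one, smul_one_mul, ← Complex.exp_eq_exp_ℂ]
  push_cast
  rfl

theorem norm_exp_le_exp_norm {E : Type*} [NormedAddCommGroup E] [NormedSpace ℂ E]
    [CompleteSpace E] (P : E →L[ℂ] E) : ‖NormedSpace.exp P‖ ≤ Real.exp ‖P‖ := by
  have h1 := NormedSpace.exp_series_hasSum_exp' (𝕂 := ℂ) P
  have h2 := NormedSpace.exp_series_hasSum_exp' (𝕂 := ℝ) ‖P‖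
  rw [← Real.exp_eq_exp_ℝ] at h2
  rw [← h1.tsum_eq]
  refine tsum_of_norm_bounded h2 fun n => ?_
  rw [norm_smul, smul_eq_mul, norm_inv, Complex.norm_natCast]
  refine mul_le_mul_of_nonneg_left ?_ (by positivity)
  -- The power `0` is separate because `‖1‖` is only known to be at most `1`: `E` may be trivial.
  cases n with
  | zero =>
    rw [pow_zero, pow_zero]
    exact ContinuousLinearMap.norm_id_le
  | succ n => exact norm_pow_le' _ n.succ_pos

/-- The scalar factor `e^{-tb}` compensates exactly for the crude bound `‖exp(tP)‖ ≤ e^{t‖P‖}`. -/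
theorem norm_exp_smul_sub_smul_one_le {E : Type*} [NormedAddCommGroup E] [NormedSpace ℂ E]
    [CompleteSpace E] {P : E →L[ℂ] E} {b : ℝ} (hP : ‖P‖ ≤ b) {t : ℝ} (ht : 0 ≤ t) :
    ‖NormedSpace.exp ((t : ℂ) • (P - (b : ℂ) • 1))‖ ≤ 1 := by
  rw [exp_smul_sub_smul_one, norm_smul, Complex.norm_real, Real.norm_of_nonneg (Real.exp_nonneg _)]
  have h1 : ‖NormedSpace.exp ((t : ℂ) • P)‖ ≤ Real.exp (t * b) := by
    refine (norm_exp_le_exp_norm _).trans (Real.exp_le_exp.2 ?_)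
    rw [norm_smul, Complex.norm_real, Real.norm_of_nonneg ht]
    exact mul_le_mul_of_nonneg_left hP ht
  calc Real.exp (-(t * b)) * ‖NormedSpace.exp ((t : ℂ) • P)‖
      ≤ Real.exp (-(t * b)) * Real.exp (t * b) :=
        mul_le_mul_of_nonneg_left h1 (Real.exp_nonneg _)
    _ = 1 := by rw [← Real.exp_add]; simp

end

section

/-! ### Grünwald formulas with one negative coefficient -/

theorem ae_translation {q : ℝ → ℂ → Prop} {f : L1R} (hf : ∀ᵐ x, q x (f x)) (y : ℝ) :
    ∀ᵐ x, q (x - y) (translation y f x) := by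
  have h := (measurePreserving_sub_right (volume : Measure ℝ) y).quasiMeasurePreserving.ae hf
  filter_upwards [h, coeFn_translation y f] with x h1 h2
  rwa [h2]

theorem isPositiveOp_translation (y : ℝ) : IsPositiveOp (translation y).toContinuousLinearMap :=
  fun _ hf => ae_translation (q := fun _ z => 0 ≤ z.re ∧ z.im = 0) hf y

theorem isPositiveOp_translationSeries {ι : Type*} {c : ι → ℝ} (hc : ∀ i, 0 ≤ c i)
    (hs : Summable c) (y : ι → ℝ) : IsPositiveOp (translationSeries (fun i => (c i : ℂ)) y) := by
  have hs' : Summable fun i => ‖(c i : ℂ)‖ := by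
    simpa [abs_of_nonneg (hc _)] using hs
  refine mem_of_hasSum_of_forall (s := {A : L1R →L[ℂ] L1R | IsPositiveOp A})
    isClosed_isPositiveOp (fun _ _ => ?_) (fun A hA B hB f hf => ?_)
    (summable_translationSeries hs' y).hasSum fun i f hf => ?_
  · exact isNonneg_zero
  · exact (hA f hf).add (hB f hf)
  · exact (isPositiveOp_translation (y i) f hf).smul (hc i)

theorem translation_zero : (translation 0).toContinuousLinearMap = 1 :=
  (hasSymbol_translation 0).unique (HasSymbol.one.congr fun k => by simp)

theorem isPositiveOp_exp_smul {P : L1R →L[ℂ] L1R} (hP : IsPositiveOp P) (b : ℝ) {t : ℝ}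
    (ht : 0 ≤ t) : IsPositiveOp (NormedSpace.exp ((t : ℂ) • (P - (b : ℂ) • 1))) := fun f hf => by
  rw [exp_smul_sub_smul_one]
  exact IsNonneg.smul (exp_smul_mem (s := {f : L1R | IsNonneg f}) isClosed_isNonneg isNonneg_zero
    (fun _ ha _ hb => ha.add hb) (fun _ hc _ ha => ha.smul hc) hP ht hf) (Real.exp_nonneg _)

variable {α h : ℝ} {p : ℕ}

theorem hasSum_grunwaldCoeff (hα : 0 < α) (p : ℕ) (h : ℝ) : HasSum (grunwaldCoeff α p h) 0 := by
  have := (hasSum_coeff_one hα).mul_left ((-1) ^ (p + 1) * h ^ (-α))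
  rwa [mul_zero] at this

/-- If only the central coefficient is negative, then `ψ_h` is the symbol of a positive operator
minus its norm. -/
theorem exists_grunwaldOp_eq_sub (hα : 0 < α) (hc : ∀ m, m ≠ p → 0 ≤ grunwaldCoeff α p h m) :
    ∃ (P : L1R →L[ℂ] L1R) (b : ℝ), IsPositiveOp P ∧ ‖P‖ ≤ b ∧
      grunwaldOp α p h = P - (b : ℂ) • 1 := by
  set a := grunwaldCoeff α p h with ha
  set y : ℕ → ℝ := fun m => (m - p) * h with hy
  -- The coefficients sum to `0`, so deleting the central one leaves the sum `-a p`. The rest being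
  -- nonnegative, this is also their `ℓ₁` norm, hence the value of `b`.
  have hsum : HasSum (Function.update a p 0) (-a p) := by
    simpa using (hasSum_grunwaldCoeff hα p h).update p 0
  have hnn : ∀ m, 0 ≤ Function.update a p 0 m := fun m => by
    rcases eq_or_ne m p with rfl | hm
    · simp
    · simpa [hm] using hc m hm
  have hnorm : HasSum (fun m => ‖((Function.update a p 0 m : ℝ) : ℂ)‖) (-a p) := by
    simpa only [Complex.norm_real, Real.norm_of_nonneg (hnn _)] using hsum
  refine ⟨translationSeries (fun m => ((Function.update a p 0 m : ℝ) : ℂ)) y, -a p,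
    isPositiveOp_translationSeries hnn hsum.summable y, ?_, ?_⟩
  · exact (norm_translationSeries_le hnorm.summable).trans hnorm.tsum_eq.le
  · have h1 := (summable_translationSeries (summable_norm_grunwaldCoeff hα p h) y).hasSum
    have h2 := (summable_translationSeries hnorm.summable y).hasSum
    have h3 := h2.add (hasSum_ite_eq p ((a p : ℂ) • (1 : L1R →L[ℂ] L1R)))
    refine (h1.unique (h3.congr_fun fun m => ?_)).trans ?_
    · rcases eq_or_ne m p with rfl | hm
      · simp [hy, translation_zero, ha]
      · simp [hm, ha]
    · rw [Complex.ofReal_neg, neg_smul, sub_neg_eq_add]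
      rfl

theorem grunwaldCoeff_nonneg_of_le_one (h0 : 0 < α) (h1 : α ≤ 1) (hh : 0 < h) {m : ℕ}
    (hm : m ≠ 0) : 0 ≤ grunwaldCoeff α 0 h m := by
  have := coeff_nonpos h0 h1 (Nat.one_le_iff_ne_zero.2 hm)
  have h2 := Real.rpow_pos_of_pos hh (-α)
  unfold grunwaldCoeff
  simp only [zero_add, pow_one, neg_one_mul]
  nlinarith

theorem grunwaldCoeff_nonneg_of_one_lt (h1 : 1 < α) (h2 : α < 2) (hh : 0 < h) {m : ℕ}
    (hm : m ≠ 1) : 0 ≤ grunwaldCoeff α 1 h m := by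
  have h3 := Real.rpow_pos_of_pos hh (-α)
  have h4 : 0 ≤ coeff α m := by
    rcases Nat.eq_zero_or_pos m with rfl | h0
    · simp [coeff_zero]
    · exact coeff_nonneg h1 h2 (by lia)
  unfold grunwaldCoeff
  norm_num
  positivity

theorem norm_exp_grunwaldOp_le_one (hα : 0 < α) (hc : ∀ m, m ≠ p → 0 ≤ grunwaldCoeff α p h m)
    {t : ℝ} (ht : 0 ≤ t) : ‖NormedSpace.exp ((t : ℂ) • grunwaldOp α p h)‖ ≤ 1 := by
  obtain ⟨P, b, -, hPb, hP⟩ := exists_grunwaldOp_eq_sub hα hc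
  rw [hP]
  exact norm_exp_smul_sub_smul_one_le hPb ht

theorem isPositiveOp_exp_grunwaldOp (hα : 0 < α) (hc : ∀ m, m ≠ p → 0 ≤ grunwaldCoeff α p h m)
    {t : ℝ} (ht : 0 ≤ t) : IsPositiveOp (NormedSpace.exp ((t : ℂ) • grunwaldOp α p h)) := by
  obtain ⟨P, b, hpos, -, hP⟩ := exists_grunwaldOp_eq_sub hα hc
  rw [hP]
  exact isPositiveOp_exp_smul hpos b ht

/-! ### The half line -/

theorem coeFn_extendByZero (f : L1Plus) :
    extendByZero f =ᵐ[volume] Set.indicator (Set.Ici (0 : ℝ)) f :=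
  MemLp.coeFn_toLp _

/-- Extension by zero as a bounded operator. -/
def extension : L1Plus →L[ℂ] L1R :=
  LinearMap.mkContinuous
    { toFun := extendByZero
      map_add' := fun f g => by
        refine Lp.ext ?_
        have h1 := (ae_restrict_iff' measurableSet_Ici).1 (Lp.coeFn_add f g)
        filter_upwards [h1, coeFn_extendByZero f, coeFn_extendByZero g,
          coeFn_extendByZero (f + g), Lp.coeFn_add (extendByZero f) (extendByZero g)]
          with x h1 h2 h3 h4 h5
        rw [h5, h4, Pi.add_apply, h2, h3]
        by_cases hx : x ∈ Set.Ici (0 : ℝ)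
        · simpa [hx] using h1 hx
        · simp [hx]
      map_smul' := fun c f => by
        refine Lp.ext ?_
        have h1 := (ae_restrict_iff' measurableSet_Ici).1 (Lp.coeFn_smul c f)
        filter_upwards [h1, coeFn_extendByZero f, coeFn_extendByZero (c • f),
          Lp.coeFn_smul c (extendByZero f)] with x h1 h2 h3 h4
        rw [RingHom.id_apply, h4, h3, Pi.smul_apply, h2]
        by_cases hx : x ∈ Set.Ici (0 : ℝ)
        · simpa [hx] using h1 hx
        · simp [hx] } 1 fun f => by
    refine le_of_eq ?_
    change ‖extendByZero f‖ = _
    rw [one_mul, extendByZero, Lp.norm_toLp, Lp.norm_def,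
      eLpNorm_indicator_eq_eLpNorm_restrict measurableSet_Ici]

theorem extension_apply (f : L1Plus) : extension f = extendByZero f := rfl

theorem norm_extension_le : ‖extension‖ ≤ 1 :=
  LinearMap.mkContinuous_norm_le _ zero_le_one _

/-- Restriction to the half line as a bounded operator. -/
def restriction : L1R →L[ℂ] L1Plus :=
  LpToLpRestrictCLM ℝ ℂ ℂ volume 1 (Set.Ici 0)

theorem norm_restriction_le : ‖restriction‖ ≤ 1 :=
  ContinuousLinearMap.opNorm_le_bound _ zero_le_one fun f => by
    rw [one_mul]
    exact norm_Lp_toLp_restrict_le _ f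

theorem coeFn_restriction (f : L1R) :
    restriction f =ᵐ[volume.restrict (Set.Ici (0 : ℝ))] f :=
  LpToLpRestrictCLM_coeFn ℂ _ f

theorem restriction_extension (f : L1Plus) : restriction (extension f) = f := by
  refine Lp.ext ((coeFn_restriction _).trans ?_)
  filter_upwards [ae_restrict_of_ae (coeFn_extendByZero f), ae_restrict_mem measurableSet_Ici]
    with x h1 h2
  rw [extension_apply, h1, Set.indicator_of_mem h2]

/-- The functions that vanish on the negative half line. -/
def supportedOnHalfLine : Set L1R :=
  {f : L1R | ∀ᵐ x, f x ∈ (if x < 0 then {0} else Set.univ : Set ℂ)}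

theorem mem_supportedOnHalfLine {f : L1R} :
    f ∈ supportedOnHalfLine ↔ ∀ᵐ x, x < 0 → f x = 0 := by
  have h : ∀ x, f x ∈ (if x < 0 then {0} else Set.univ : Set ℂ) ↔ (x < 0 → f x = 0) := fun x => ?_
  · simp only [supportedOnHalfLine, Set.mem_ofPred_eq, h]
  split_ifs with hx <;> simp [hx]

theorem isClosed_supportedOnHalfLine : IsClosed supportedOnHalfLine :=
  isClosed_setOf_ae_mem _ fun x => by
    split_ifs
    · exact isClosed_singleton
    · exact isClosed_univ

theorem extension_mem (f : L1Plus) : extension f ∈ supportedOnHalfLine := by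
  rw [mem_supportedOnHalfLine]
  filter_upwards [coeFn_extendByZero f] with x h1 h2
  rw [extension_apply, h1, Set.indicator_of_notMem (by simpa using h2)]

theorem extension_restriction {f : L1R} (hf : f ∈ supportedOnHalfLine) :
    extension (restriction f) = f := by
  refine Lp.ext ?_
  have h1 := (ae_restrict_iff' measurableSet_Ici).1 (coeFn_restriction f)
  filter_upwards [mem_supportedOnHalfLine.1 hf, h1, coeFn_extendByZero (restriction f)]
    with x h2 h3 h4
  rw [extension_apply, h4]
  by_cases hx : x ∈ Set.Ici (0 : ℝ)
  · rw [Set.indicator_of_mem hx, h3 hx]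
  · rw [Set.indicator_of_notMem hx, h2 (by simpa using hx)]

theorem zero_mem_supportedOnHalfLine : 0 ∈ supportedOnHalfLine := by
  rw [mem_supportedOnHalfLine]
  filter_upwards [Lp.coeFn_zero ℂ 1 (volume : Measure ℝ)] with x hx _
  rw [hx]
  rfl

theorem add_mem_supportedOnHalfLine {f g : L1R} (hf : f ∈ supportedOnHalfLine)
    (hg : g ∈ supportedOnHalfLine) : f + g ∈ supportedOnHalfLine := by
  rw [mem_supportedOnHalfLine] at *
  filter_upwards [hf, hg, Lp.coeFn_add f g] with x h1 h2 h3 hx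
  rw [h3, Pi.add_apply, h1 hx, h2 hx, add_zero]

theorem smul_mem_supportedOnHalfLine (c : ℂ) {f : L1R} (hf : f ∈ supportedOnHalfLine) :
    c • f ∈ supportedOnHalfLine := by
  rw [mem_supportedOnHalfLine] at *
  filter_upwards [hf, Lp.coeFn_smul c f] with x h1 h2 hx
  rw [h2, Pi.smul_apply, h1 hx, smul_zero]

/-- Without shift (`p = 0`) all translations are by `m h ≥ 0`, so supports move only to the right.
-/
theorem grunwaldOp_mem_supportedOnHalfLine (hα : 0 < α) (hh : 0 ≤ h) {f : L1R}
    (hf : f ∈ supportedOnHalfLine) : grunwaldOp α 0 h f ∈ supportedOnHalfLine := by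
  have hsum := (ContinuousLinearMap.apply ℂ L1R f).hasSum
    (summable_translationSeries (summable_norm_grunwaldCoeff hα 0 h)
      fun m => ((m : ℝ) - (0 : ℕ)) * h).hasSum
  refine mem_of_hasSum_of_forall isClosed_supportedOnHalfLine zero_mem_supportedOnHalfLine
    (fun _ ha _ hb => add_mem_supportedOnHalfLine ha hb) hsum fun m => ?_
  refine smul_mem_supportedOnHalfLine _ ?_
  have h1 := ae_translation (q := fun x z => x < 0 → z = 0) (mem_supportedOnHalfLine.1 hf)
    (((m : ℝ) - (0 : ℕ)) * h)
  rw [mem_supportedOnHalfLine]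
  filter_upwards [h1] with x h2 hx
  refine h2 ?_
  have : 0 ≤ ((m : ℝ) - (0 : ℕ)) * h := by
    rw [Nat.cast_zero, sub_zero]
    positivity
  linarith

/-- For `p = 0`, the semigroup leaves `L₁(ℝ₊)` invariant. -/
theorem exists_halfLine_semigroup (h0 : 0 < α) (h1 : α ≤ 1) (hh : 0 < h) :
    ∃ S : ℝ → L1Plus →L[ℂ] L1Plus,
      (∀ t : ℝ, 0 ≤ t → ∀ f : L1Plus,
        extendByZero (S t f) = semigroup α 0 h t (extendByZero f)) ∧
      IsC0Semigroup S ∧ ∀ t : ℝ, 0 ≤ t → IsPositiveOp (S t) ∧ ‖S t‖ ≤ 1 := by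
  set U : ℝ → L1R →L[ℂ] L1R := fun t => NormedSpace.exp ((t : ℂ) • grunwaldOp α 0 h) with hU
  have hC0 : IsC0Semigroup U := isC0Semigroup_exp _
  have hc : ∀ m, m ≠ 0 → 0 ≤ grunwaldCoeff α 0 h m := fun m hm =>
    grunwaldCoeff_nonneg_of_le_one h0 h1 hh hm
  have hmem : ∀ t, 0 ≤ t → ∀ f ∈ supportedOnHalfLine, U t f ∈ supportedOnHalfLine :=
    fun t ht f hf => exp_smul_mem isClosed_supportedOnHalfLine zero_mem_supportedOnHalfLine
      (fun _ ha _ hb => add_mem_supportedOnHalfLine ha hb)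
      (fun c _ _ ha => smul_mem_supportedOnHalfLine (c : ℂ) ha)
      (fun _ hf => grunwaldOp_mem_supportedOnHalfLine h0 hh.le hf) ht hf
  -- Invariance makes `extension` undo `restriction` on the values of `U t`; this is what makes the
  -- compression `restriction ∘ U t ∘ extension` multiplicative in `t`.
  have hext : ∀ t, 0 ≤ t → ∀ f : L1Plus,
      extension (restriction (U t (extension f))) = U t (extension f) := fun t ht f =>
    extension_restriction (hmem t ht _ (extension_mem f))
  refine ⟨fun t => restriction.comp ((U t).comp extension), fun t ht f => ?_, ⟨?_, ?_, ?_⟩, ?_⟩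
  · rw [semigroup_eq_exp h0]
    exact hext t ht f
  · ext1 f
    simp only [ContinuousLinearMap.comp_apply, hC0.zero, ContinuousLinearMap.id_apply,
      restriction_extension]
  · intro s t hs ht
    ext1 f
    simp only [ContinuousLinearMap.comp_apply, hC0.add s t hs ht, hext t ht]
  · intro f
    have := (restriction.continuous.tendsto _).comp (hC0.tendsto (extension f))
    rw [restriction_extension] at this
    exact this
  · intro t ht
    refine ⟨fun f hf => ?_, ?_⟩
    · have h2 : IsNonneg (extension f) := by
        have h3 := (ae_restrict_iff' measurableSet_Ici).1 hf
        filter_upwards [h3, coeFn_extendByZero f] with x h4 h5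
        rw [extension_apply, h5]
        by_cases hx : x ∈ Set.Ici (0 : ℝ)
        · simpa [hx] using h4 hx
        · simp [hx]
      have h3 := isPositiveOp_exp_grunwaldOp h0 hc ht _ h2
      filter_upwards [ae_restrict_of_ae h3, coeFn_restriction (U t (extension f))] with x h4 h5
      rw [ContinuousLinearMap.comp_apply, ContinuousLinearMap.comp_apply, h5]
      exact h4
    · have h2 := norm_exp_grunwaldOp_le_one h0 hc ht
      refine (ContinuousLinearMap.opNorm_comp_le _ _).trans
        (mul_le_one₀ norm_restriction_le (norm_nonneg _) ?_)
      exact (ContinuousLinearMap.opNorm_comp_le _ _).trans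
        (mul_le_one₀ h2 (norm_nonneg _) norm_extension_le)

end

/-! ### Absolutely convergent Fourier series -/

/-- The summand is the minimum over `[n, n+1]` of the derivative of `arctan(x / l)`, so the sum is
dominated by a telescoping one whose bound does not depend on `l`. -/
theorem sum_div_sq_add_sq_le {l : ℝ} (hl : 0 < l) (N : ℕ) :
    ∑ n ∈ Finset.range N, l / (l ^ 2 + ((n : ℝ) + 1) ^ 2) ≤ Real.pi / 2 := by
  have hterm : ∀ n : ℕ, l / (l ^ 2 + ((n : ℝ) + 1) ^ 2) ≤
      Real.arctan (((n + 1 : ℕ) : ℝ) / l) - Real.arctan ((n : ℝ) / l) := by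
    intro n
    have hd : ∀ x : ℝ, HasDerivAt (fun x => Real.arctan (x / l)) (l / (l ^ 2 + x ^ 2)) x := by
      intro x
      have h := ((hasDerivAt_id x).div_const l).arctan
      convert h using 1
      simp only [id]
      field_simp
      rfl
    have h := (convex_Icc (n : ℝ) (n + 1)).mul_sub_le_image_sub_of_le_deriv
      (f := fun x => Real.arctan (x / l)) (C := l / (l ^ 2 + ((n : ℝ) + 1) ^ 2))
      (fun x _ => (hd x).continuousAt.continuousWithinAt)
      (fun x _ => (hd x).differentiableAt.differentiableWithinAt) (fun x hx => by
        rw [interior_Icc] at hx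
        rw [(hd x).deriv]
        have h1 : (0 : ℝ) ≤ n := n.cast_nonneg
        have h2 : x ^ 2 ≤ ((n : ℝ) + 1) ^ 2 := pow_le_pow_left₀ (h1.trans hx.1.le) hx.2.le 2
        gcongr) n (by simp) (n + 1) (by simp) (by simp)
    push_cast
    simpa using h
  refine (Finset.sum_le_sum fun n _ => hterm n).trans ?_
  rw [Finset.sum_range_sub fun n : ℕ => Real.arctan ((n : ℝ) / l)]
  simpa using (Real.arctan_lt_pi_div_two _).le

theorem exists_hasSum_div_sq_add_sq {l : ℝ} (hl : 1 ≤ l) :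
    ∃ S ≤ 1 + Real.pi, HasSum (fun n : ℤ => l / (l ^ 2 + (n : ℝ) ^ 2)) S := by
  have hl0 : 0 < l := by linarith
  have hnn : ∀ n : ℕ, 0 ≤ l / (l ^ 2 + ((n : ℝ) + 1) ^ 2) := fun n => by positivity
  have hs : Summable fun n : ℕ => l / (l ^ 2 + ((n : ℝ) + 1) ^ 2) :=
    summable_of_sum_range_le hnn (sum_div_sq_add_sq_le hl0)
  have hle : ∑' n : ℕ, l / (l ^ 2 + ((n : ℝ) + 1) ^ 2) ≤ Real.pi / 2 :=
    Real.tsum_le_of_sum_range_le hnn (sum_div_sq_add_sq_le hl0)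
  have h1 : HasSum (fun n : ℕ => l / (l ^ 2 + (((n : ℕ) : ℤ) : ℝ) ^ 2))
      (∑' n : ℕ, l / (l ^ 2 + ((n : ℝ) + 1) ^ 2) + l / (l ^ 2)) := by
    rw [← hasSum_nat_add_iff' 1]
    simpa using hs.hasSum
  have h2 : HasSum (fun n : ℕ => l / (l ^ 2 + ((-((n : ℕ) + 1 : ℤ) : ℤ) : ℝ) ^ 2))
      (∑' n : ℕ, l / (l ^ 2 + ((n : ℝ) + 1) ^ 2)) := by
    refine hs.hasSum.congr_fun fun n => ?_
    push_cast
    rw [neg_sq]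
  refine ⟨_, ?_, HasSum.of_nat_of_neg_add_one h1 h2⟩
  have : l / l ^ 2 ≤ 1 := by
    rw [div_le_one (by positivity)]
    nlinarith
  linarith

/-- A Bernstein–Carlson criterion: quantitative absolute convergence of the Fourier series of a
periodic function with square integrable derivative. -/
theorem exists_fourier_hasSum {F F' : ℝ → ℂ} {G : ℝ → ℝ} {l : ℝ} (hF : Continuous F)
    (hper : Function.Periodic F (2 * Real.pi))
    (hd : ∀ x ∈ Set.Ioo 0 (2 * Real.pi), HasDerivAt F (F' x) x) (hl : 1 ≤ l)
    (hG : IntegrableOn G (Set.Ioc 0 (2 * Real.pi)))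
    (hb : ∀ x ∈ Set.Ioo 0 (2 * Real.pi), l * ‖F x‖ ^ 2 + l⁻¹ * ‖F' x‖ ^ 2 ≤ G x) :
    ∃ c : ℤ → ℂ, (Summable fun n => ‖c n‖) ∧
      ∑' n, ‖c n‖ ≤ (∫ x in Set.Ioc 0 (2 * Real.pi), G x) + (1 + Real.pi) ∧
      ∀ x : ℝ, HasSum (fun n => c n * Complex.exp (Complex.I * n * x)) (F x) := by
  have hl0 : 0 < l := by linarith
  have hT : 0 < 2 * Real.pi := Real.two_pi_pos
  have : Fact (0 < 2 * Real.pi) := ⟨hT⟩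
  let f : C(AddCircle (2 * Real.pi), ℂ) :=
    ⟨hper.lift, continuous_coinduced_dom.2 hF⟩
  have hf : ∀ x : ℝ, f x = F x := fun x => hper.lift_coe x
  set c : ℤ → ℂ := fourierCoeff f with hc
  have hcOn : ∀ n, c n = fourierCoeffOn hT F n := by
    intro n
    rw [hc, fourierCoeff_eq_intervalIntegral _ _ 0, fourierCoeffOn_eq_integral]
    simp only [fourier_coe_apply, hf, zero_add, sub_zero]
  have hIoo : ∀ᵐ x ∂(volume.restrict (Set.Ioc 0 (2 * Real.pi))), x ∈ Set.Ioo 0 (2 * Real.pi) := by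
    rw [← restrict_Ioo_eq_restrict_Ioc]
    exact ae_restrict_mem measurableSet_Ioo
  -- `F'` is arbitrary off the open interval, so measurability is taken from `deriv F`, which agrees
  -- with it almost everywhere.
  have hF'm : AEStronglyMeasurable F' (volume.restrict (Set.Ioc 0 (2 * Real.pi))) :=
    (stronglyMeasurable_deriv F).aestronglyMeasurable.congr
      (hIoo.mono fun x hx => (hd x hx).deriv)
  have hFi : Integrable (fun x => ‖F x‖ ^ 2) (volume.restrict (Set.Ioc 0 (2 * Real.pi))) := by
    have : Continuous fun x => ‖F x‖ ^ 2 := by fun_prop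
    exact (this.integrableOn_Icc).mono_set Set.Ioc_subset_Icc_self
  have hF'i : Integrable (fun x => ‖F' x‖ ^ 2) (volume.restrict (Set.Ioc 0 (2 * Real.pi))) := by
    refine Integrable.mono' (hG.const_mul l) (hF'm.norm.pow 2) (hIoo.mono fun x hx => ?_)
    have h1 := hb x hx
    rw [Real.norm_of_nonneg (by positivity)]
    calc ‖F' x‖ ^ 2 = l * (l⁻¹ * ‖F' x‖ ^ 2) := by field_simp
      _ ≤ l * G x := by
        have : 0 ≤ l * ‖F x‖ ^ 2 := by positivity
        gcongr
        linarith
  have hFL2 : MemLp F 2 (volume.restrict (Set.Ioc 0 (2 * Real.pi))) :=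
    (memLp_two_iff_integrable_sq_norm hF.aestronglyMeasurable).2 hFi
  have hF'L2 : MemLp F' 2 (volume.restrict (Set.Ioc 0 (2 * Real.pi))) :=
    (memLp_two_iff_integrable_sq_norm hF'm).2 hF'i
  have hF'int : IntervalIntegrable F' volume 0 (2 * Real.pi) := by
    rw [intervalIntegrable_iff_integrableOn_Ioc_of_le hT.le]
    exact hF'L2.integrable one_le_two
  -- Integration by parts; the boundary term vanishes by periodicity.
  have hcd : ∀ n : ℤ, (n : ℝ) ^ 2 * ‖c n‖ ^ 2 ≤ ‖fourierCoeffOn hT F' n‖ ^ 2 := by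
    intro n
    rcases eq_or_ne n 0 with rfl | hn
    · simp
    · have h := fourierCoeffOn_of_hasDerivAt_Ioo hT hn (f := F) (f' := F')
        hF.continuousOn (by simpa [hT.le] using hd) hF'int
      have h0 : F (2 * Real.pi) = F 0 := by simpa using hper 0
      rw [← hcOn, h0, sub_self, mul_zero, zero_sub] at h
      have hn' : (n : ℂ) ≠ 0 := by exact_mod_cast hn
      have hpi : (Real.pi : ℂ) ≠ 0 := by exact_mod_cast Real.pi_ne_zero
      have h1 : (n : ℂ) * (Complex.I * c n) = fourierCoeffOn hT F' n := by
        rw [h]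
        push_cast
        field_simp
        simp
      rw [← h1, norm_mul, norm_mul, Complex.norm_I, one_mul, mul_pow, ← Complex.ofReal_intCast,
        Complex.norm_real, Real.norm_eq_abs, sq_abs]
  have hsum1 := hasSum_sq_fourierCoeffOn hT hFL2
  have hsum2 := hasSum_sq_fourierCoeffOn hT hF'L2
  simp only [← hcOn] at hsum1
  obtain ⟨S, hS, hsum3⟩ := exists_hasSum_div_sq_add_sq hl
  have hsum := ((hsum1.mul_left l).add (hsum2.mul_left l⁻¹)).add hsum3
  -- Cauchy–Schwarz in additive form: `r ≤ A r² + A⁻¹` with weight `A = (l² + n²) / l`. Parseval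
  -- sums the first part, and `∑ A⁻¹` is bounded uniformly in `l ≥ 1`.
  have hle : ∀ n, ‖c n‖ ≤ l * ‖c n‖ ^ 2 + l⁻¹ * ‖fourierCoeffOn hT F' n‖ ^ 2 +
      l / (l ^ 2 + (n : ℝ) ^ 2) := by
    intro n
    have h1 := mul_le_mul_of_nonneg_left (hcd n) (inv_nonneg.2 hl0.le)
    set A := (l ^ 2 + (n : ℝ) ^ 2) / l with hA
    have hA0 : 0 < A := by positivity
    have h2 : l / (l ^ 2 + (n : ℝ) ^ 2) = A⁻¹ := by rw [hA, inv_div]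
    have h3 : A * ‖c n‖ ^ 2 = l * ‖c n‖ ^ 2 + l⁻¹ * ((n : ℝ) ^ 2 * ‖c n‖ ^ 2) := by
      rw [hA]; field_simp
    have h4 : ‖c n‖ ≤ A * ‖c n‖ ^ 2 + A⁻¹ := by
      have h5 : A * ‖c n‖ ^ 2 + A⁻¹ - ‖c n‖ =
          A⁻¹ * ((A * ‖c n‖ - 1 / 2) ^ 2 + 3 / 4) := by field_simp; ring
      have h6 : 0 ≤ A⁻¹ * ((A * ‖c n‖ - 1 / 2) ^ 2 + 3 / 4) := by positivity
      linarith
    rw [h2]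
    linarith
  have hcs : Summable fun n => ‖c n‖ :=
    Summable.of_nonneg_of_le (fun _ => norm_nonneg _) hle hsum.summable
  refine ⟨c, hcs, ?_, fun x => ?_⟩
  · refine (hasSum_le hle hcs.hasSum hsum).trans (add_le_add ?_ hS)
    simp only [sub_zero, smul_eq_mul]
    rw [intervalIntegral.integral_of_le hT.le, intervalIntegral.integral_of_le hT.le]
    have h1 : ∫ x in Set.Ioc 0 (2 * Real.pi), (l * ‖F x‖ ^ 2 + l⁻¹ * ‖F' x‖ ^ 2) ≤
        ∫ x in Set.Ioc 0 (2 * Real.pi), G x :=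
      integral_mono_ae ((hFi.const_mul l).add (hF'i.const_mul l⁻¹)) hG (hIoo.mono hb)
    rw [integral_add (hFi.const_mul l) (hF'i.const_mul l⁻¹), integral_const_mul,
      integral_const_mul] at h1
    have h2 : (2 * Real.pi)⁻¹ ≤ 1 := inv_le_one_of_one_le₀ (by linarith [Real.pi_gt_three])
    have h3 : 0 ≤ l * ∫ x in Set.Ioc 0 (2 * Real.pi), ‖F x‖ ^ 2 :=
      mul_nonneg hl0.le (integral_nonneg fun _ => by positivity)
    have h4 : 0 ≤ l⁻¹ * ∫ x in Set.Ioc 0 (2 * Real.pi), ‖F' x‖ ^ 2 :=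
      mul_nonneg (inv_nonneg.2 hl0.le) (integral_nonneg fun _ => by positivity)
    refine le_trans ?_ ((mul_le_of_le_one_left (add_nonneg h3 h4) h2).trans h1)
    exact le_of_eq (by ring)
  · have := has_pointwise_sum_fourier_series_of_summable (f := f) hcs.of_norm x
    rw [hf] at this
    refine this.congr_fun fun n => ?_
    rw [fourier_coe_apply, smul_eq_mul]
    congr 2
    push_cast
    have : (Real.pi : ℂ) ≠ 0 := by exact_mod_cast Real.pi_ne_zero
    field_simp

section

/-! ### Fourier series of functions with a power singularity -/

theorem two_sin_half_pos {x : ℝ} (hx : x ∈ Set.Ioo 0 (2 * Real.pi)) : 0 < 2 * Real.sin (x / 2) := by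
  have := Real.sin_pos_of_pos_of_lt_pi (x := x / 2) (by linarith [hx.1]) (by linarith [hx.2])
  linarith

/-- Majorant of the square of a function that behaves like `exp(-c |x|^α)`. -/
def majorant (α c : ℝ) (x : ℝ) : ℝ :=
  (1 + 2 / c) ^ 2 * (Real.exp (-(c * (2 / Real.pi) ^ α) * x ^ α) +
    (α + 1) ^ 2 * (1 + (2 / Real.pi) ^ (2 * α - 2)) *
      (x ^ (2 * α - 2) * Real.exp (-(c * (2 / Real.pi) ^ α) * x ^ α)))

/-- The threshold `α > 1/2` is integrability of `x^{2α-2}` at `0`. -/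
theorem integrableOn_majorant {α c : ℝ} (hα : 1 / 2 < α) (hc : 0 < c) :
    IntegrableOn (majorant α c) (Set.Ioi 0) := by
  have hc' : 0 < c * (2 / Real.pi) ^ α :=
    mul_pos hc (Real.rpow_pos_of_pos (div_pos two_pos Real.pi_pos) _)
  have h1 := integrableOn_rpow_mul_exp_neg_mul_rpow (p := α) (s := 0) (by norm_num)
    (by linarith) hc'
  have h2 := integrableOn_rpow_mul_exp_neg_mul_rpow (p := α) (s := 2 * α - 2) (by linarith)
    (by linarith) hc'
  simp only [Real.rpow_zero, one_mul] at h1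
  exact (h1.add (h2.const_mul _)).const_mul _

theorem majorant_nonneg {α c x : ℝ} (hc : 0 < c) (hx : 0 ≤ x) : 0 ≤ majorant α c x := by
  have := Real.pi_pos
  unfold majorant
  positivity

/-- Half of the exponential absorbs the factor `1 + u`; squaring restores the full rate `c`. -/
theorem one_add_mul_exp_le {c u : ℝ} (hc : 0 < c) (hu : 0 ≤ u) :
    ((1 + u) * Real.exp (-c * u)) ^ 2 ≤ (1 + 2 / c) ^ 2 * Real.exp (-c * u) := by
  have h1 : 1 + u ≤ (1 + 2 / c) * Real.exp (c * u / 2) := by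
    have h2 : c * u / 2 ≤ Real.exp (c * u / 2) := by
      linarith [Real.add_one_le_exp (c * u / 2)]
    have h3 : 1 ≤ Real.exp (c * u / 2) := Real.one_le_exp (by positivity)
    have h4 : u = 2 / c * (c * u / 2) := by field_simp
    have h5 : 2 / c * (c * u / 2) ≤ 2 / c * Real.exp (c * u / 2) := by gcongr
    linarith
  calc ((1 + u) * Real.exp (-c * u)) ^ 2
      ≤ ((1 + 2 / c) * Real.exp (c * u / 2) * Real.exp (-c * u)) ^ 2 := by gcongr
    _ = (1 + 2 / c) ^ 2 * Real.exp (-c * u) := by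
      rw [mul_assoc, ← Real.exp_add, mul_pow, ← Real.exp_nat_mul]
      congr 2
      push_cast
      ring

/-- The pointwise estimate behind `exists_fourier_hasSum`, in terms of the distance `m` to the
singularity. -/
theorem sq_add_sq_le_majorant {α c l s m a b : ℝ} (hα : 0 < α) (hc : 0 < c) (hl : 0 < l)
    (hm : 0 < m) (hs1 : 2 / Real.pi * m ≤ s) (hs2 : s ≤ m) (ha0 : 0 ≤ a) (hb0 : 0 ≤ b)
    (ha : a ≤ (1 + (l * s) ^ α) * Real.exp (-c * (l * s) ^ α))
    (hb : b ≤ (α + 1) * l * (l * s) ^ (α - 1) *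
      ((1 + (l * s) ^ α) * Real.exp (-c * (l * s) ^ α))) :
    l * a ^ 2 + l⁻¹ * b ^ 2 ≤ l * majorant α c (l * m) := by
  have hpi := Real.pi_pos
  have hr : 0 < 2 / Real.pi := by positivity
  have hs : 0 < s := (mul_pos hr hm).trans_le hs1
  set y := l * s with hy
  have hy0 : 0 < y := mul_pos hl hs
  have hy1 : 2 / Real.pi * (l * m) ≤ y := by
    rw [hy, mul_left_comm]; gcongr
  have hy2 : y ≤ l * m := by rw [hy]; gcongr
  have hx0 : 0 < l * m := mul_pos hl hm
  set E := (1 + y ^ α) * Real.exp (-c * y ^ α) with hE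
  have hu : 0 ≤ y ^ α := Real.rpow_nonneg hy0.le _
  have hE0 : 0 ≤ E := by positivity
  have hexp : Real.exp (-c * y ^ α) ≤ Real.exp (-(c * (2 / Real.pi) ^ α) * (l * m) ^ α) := by
    refine Real.exp_le_exp.2 ?_
    have : (2 / Real.pi * (l * m)) ^ α ≤ y ^ α := by gcongr
    rw [Real.mul_rpow hr.le hx0.le] at this
    nlinarith
  -- The exponent may have either sign, so `y` is compared with `l * m` from above or from below;
  -- the constant covers both cases.
  have hpow : y ^ (2 * α - 2) ≤ (1 + (2 / Real.pi) ^ (2 * α - 2)) * (l * m) ^ (2 * α - 2) := by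
    have h1 : 0 ≤ (2 / Real.pi) ^ (2 * α - 2) := Real.rpow_nonneg hr.le _
    have h2 : 0 ≤ (l * m) ^ (2 * α - 2) := Real.rpow_nonneg hx0.le _
    rcases le_total 0 (2 * α - 2) with h | h
    · have := Real.rpow_le_rpow hy0.le hy2 h
      nlinarith
    · have := Real.rpow_le_rpow_of_nonpos (by positivity) hy1 h
      rw [Real.mul_rpow hr.le hx0.le] at this
      nlinarith
  have hEle : E ^ 2 ≤ (1 + 2 / c) ^ 2 * Real.exp (-(c * (2 / Real.pi) ^ α) * (l * m) ^ α) :=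
    (one_add_mul_exp_le hc hu).trans (by gcongr)
  have hsq : (y ^ (α - 1)) ^ 2 = y ^ (2 * α - 2) := by
    rw [← Real.rpow_natCast, ← Real.rpow_mul hy0.le]
    congr 1
    push_cast
    ring
  calc l * a ^ 2 + l⁻¹ * b ^ 2
      ≤ l * E ^ 2 + l⁻¹ * ((α + 1) * l * y ^ (α - 1) * E) ^ 2 := by gcongr
    _ = l * (E ^ 2 + (α + 1) ^ 2 * (y ^ (2 * α - 2) * E ^ 2)) := by
      rw [← hsq]; field_simp
    _ ≤ l * ((1 + 2 / c) ^ 2 * Real.exp (-(c * (2 / Real.pi) ^ α) * (l * m) ^ α) +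
          (α + 1) ^ 2 * ((1 + (2 / Real.pi) ^ (2 * α - 2)) * (l * m) ^ (2 * α - 2) *
            ((1 + 2 / c) ^ 2 * Real.exp (-(c * (2 / Real.pi) ^ α) * (l * m) ^ α)))) := by
      gcongr
    _ = l * majorant α c (l * m) := by rw [majorant]; ring

/-- The scaling `l Ψ(l x)` preserves the integral over the half line, which makes the bound
independent of `l`. Two terms occur because the singularity appears at both ends of the period. -/
theorem integrableOn_comp_and_integral_le {Ψ : ℝ → ℝ} (hΨ : IntegrableOn Ψ (Set.Ioi 0))
    (h0 : ∀ x, 0 ≤ x → 0 ≤ Ψ x) {l T : ℝ} (hl : 0 < l) (hT : 0 < T) :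
    IntegrableOn (fun x => l * Ψ (l * x) + l * Ψ (l * (T - x))) (Set.Ioc 0 T) ∧
      ∫ x in Set.Ioc 0 T, (l * Ψ (l * x) + l * Ψ (l * (T - x))) ≤
        2 * ∫ x in Set.Ioi 0, Ψ x := by
  have h1 : IntervalIntegrable (fun x => l * Ψ (l * x)) volume 0 T := by
    rw [intervalIntegrable_iff_integrableOn_Ioc_of_le hT.le]
    refine IntegrableOn.mono_set ?_ (Set.Ioc_subset_Ioi_self)
    exact ((integrableOn_Ioi_comp_mul_left_iff Ψ 0 hl).2 (by simpa using hΨ)).const_mul l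
  have h2 : IntervalIntegrable (fun x => l * Ψ (l * (T - x))) volume 0 T := by
    simpa using (h1.comp_sub_left T).symm
  have h3 : ∫ x in 0..T, l * Ψ (l * x) ≤ ∫ x in Set.Ioi 0, Ψ x := by
    rw [intervalIntegral.integral_const_mul, intervalIntegral.mul_integral_comp_mul_left, mul_zero,
      intervalIntegral.integral_of_le (by positivity)]
    exact setIntegral_mono_set hΨ
      ((ae_restrict_mem measurableSet_Ioi).mono fun x hx => h0 x (le_of_lt hx))
      (Eventually.of_forall Set.Ioc_subset_Ioi_self)
  have h4 : ∫ x in 0..T, l * Ψ (l * (T - x)) = ∫ x in 0..T, l * Ψ (l * x) := by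
    rw [intervalIntegral.integral_comp_sub_left fun x => l * Ψ (l * x)]
    simp
  refine ⟨?_, ?_⟩
  · rw [← intervalIntegrable_iff_integrableOn_Ioc_of_le hT.le]
    exact h1.add h2
  · rw [← intervalIntegral.integral_of_le hT.le, intervalIntegral.integral_add h1 h2, h4]
    linarith

/-- Uniform bound for the Fourier coefficients of functions that behave like
`exp(-c |l x|^α)` near their singularity. -/
theorem exists_fourier_bound {α c : ℝ} (hα : 1 / 2 < α) (hc : 0 < c) :
    ∃ K : ℝ, ∀ (l : ℝ) (F F' : ℝ → ℂ), 1 ≤ l → Continuous F →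
      Function.Periodic F (2 * Real.pi) →
      (∀ x ∈ Set.Ioo 0 (2 * Real.pi), HasDerivAt F (F' x) x) →
      (∀ x ∈ Set.Ioo 0 (2 * Real.pi), ‖F x‖ ≤ (1 + (l * (2 * Real.sin (x / 2))) ^ α) *
        Real.exp (-c * (l * (2 * Real.sin (x / 2))) ^ α)) →
      (∀ x ∈ Set.Ioo 0 (2 * Real.pi), ‖F' x‖ ≤
        (α + 1) * l * (l * (2 * Real.sin (x / 2))) ^ (α - 1) *
        ((1 + (l * (2 * Real.sin (x / 2))) ^ α) *
          Real.exp (-c * (l * (2 * Real.sin (x / 2))) ^ α))) →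
      ∃ a : ℤ → ℂ, (Summable fun n => ‖a n‖) ∧ ∑' n, ‖a n‖ ≤ K ∧
        ∀ x : ℝ, HasSum (fun n => a n * Complex.exp (Complex.I * n * x)) (F x) := by
  refine ⟨2 * (∫ x in Set.Ioi 0, majorant α c x) + (1 + Real.pi), ?_⟩
  intro l F F' hl hF hper hd hF1 hF2
  have hl0 : 0 < l := by linarith
  have hα0 : 0 < α := by linarith
  have hpi := Real.pi_pos
  obtain ⟨hG, hGle⟩ := integrableOn_comp_and_integral_le (integrableOn_majorant hα hc)
    (fun x hx => majorant_nonneg hc hx) hl0 Real.two_pi_pos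
  obtain ⟨a, ha, haK, hsum⟩ := exists_fourier_hasSum hF hper hd hl hG fun x hx => by
    have hn1 : 0 ≤ l * majorant α c (l * x) :=
      mul_nonneg hl0.le (majorant_nonneg hc (mul_nonneg hl0.le hx.1.le))
    have hn2 : 0 ≤ l * majorant α c (l * (2 * Real.pi - x)) :=
      mul_nonneg hl0.le (majorant_nonneg hc (mul_nonneg hl0.le (by linarith [hx.2])))
    -- The distance to the nearer singularity is `x` or `2π - x`; Jordan's inequality compares it
    -- with `2 sin(x/2)`.
    rcases le_total x Real.pi with h | h
    · have h1 := Real.mul_le_sin (x := x / 2) (by linarith [hx.1]) (by linarith)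
      have h2 := Real.sin_le (x := x / 2) (by linarith [hx.1])
      have := sq_add_sq_le_majorant hα0 hc hl0 hx.1 (s := 2 * Real.sin (x / 2)) (by linarith)
        (by linarith) (norm_nonneg _) (norm_nonneg _) (hF1 x hx) (hF2 x hx)
      linarith
    · have hsin : Real.sin (x / 2) = Real.sin ((2 * Real.pi - x) / 2) := by
        rw [← Real.sin_pi_sub]; congr 1; ring
      have h1 := Real.mul_le_sin (x := (2 * Real.pi - x) / 2) (by linarith [hx.2]) (by linarith)
      have h2 := Real.sin_le (x := (2 * Real.pi - x) / 2) (by linarith [hx.2])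
      rw [← hsin] at h1 h2
      have := sq_add_sq_le_majorant hα0 hc hl0 (m := 2 * Real.pi - x) (by linarith [hx.2])
        (s := 2 * Real.sin (x / 2)) (by linarith)
        (by linarith) (norm_nonneg _) (norm_nonneg _) (hF1 x hx) (hF2 x hx)
      linarith
  exact ⟨a, ha, haK.trans (by linarith), hsum⟩

/-! ### The periodic symbol -/

/-- The `2π`-periodic function `g` with `ψ_h(k) = h^{-α} g(kh)`. -/
def periodicSymbol (α : ℝ) (p : ℕ) (x : ℝ) : ℂ :=
  (-1) ^ (p + 1) * Complex.exp (-(Complex.I * p * x)) *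
    (1 - Complex.exp (Complex.I * x)) ^ (α : ℂ)

variable {α h : ℝ} {p : ℕ}

theorem symbol_eq (α : ℝ) (p : ℕ) (h k : ℝ) :
    symbol α p h k = ((h ^ (-α) : ℝ) : ℂ) * periodicSymbol α p (k * h) := by
  unfold symbol periodicSymbol
  push_cast
  rw [← mul_assoc Complex.I (k : ℂ), ← mul_assoc (Complex.I * p)]
  ring

theorem periodic_periodicSymbol (α : ℝ) (p : ℕ) :
    Function.Periodic (periodicSymbol α p) (2 * Real.pi) := by
  intro x
  unfold periodicSymbol
  have h1 : Complex.exp (Complex.I * ((x + 2 * Real.pi : ℝ) : ℂ)) =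
      Complex.exp (Complex.I * x) := by
    rw [Complex.exp_eq_exp_iff_exists_int]
    exact ⟨1, by push_cast; ring⟩
  have h2 : Complex.exp (-(Complex.I * p * ((x + 2 * Real.pi : ℝ) : ℂ))) =
      Complex.exp (-(Complex.I * p * x)) := by
    rw [Complex.exp_eq_exp_iff_exists_int]
    exact ⟨-p, by push_cast; ring⟩
  rw [h1, h2]

theorem continuous_periodicSymbol (hα : 0 < α) (p : ℕ) : Continuous (periodicSymbol α p) := by
  have h := (continuousOn_one_sub_cpow hα).comp_continuous
    (f := fun x : ℝ => Complex.exp (Complex.I * x)) (by fun_prop)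
    (fun x => by simp)
  unfold periodicSymbol
  exact (by fun_prop : Continuous fun x : ℝ => (-1) ^ (p + 1) *
    Complex.exp (-(Complex.I * p * x))).mul h

theorem one_sub_exp_eq (x : ℝ) : 1 - Complex.exp (Complex.I * x) =
    ((2 * Real.sin (x / 2) : ℝ) : ℂ) * Complex.exp (((x - Real.pi) / 2 : ℝ) * Complex.I) := by
  have h1 : Complex.exp (((x - Real.pi) / 2 : ℝ) * Complex.I) =
      -Complex.I * Complex.exp (((x / 2 : ℝ) : ℂ) * Complex.I) := by
    have : Complex.exp (-(Real.pi / 2 : ℝ) * Complex.I) = -Complex.I := by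
      push_cast
      rw [neg_mul, Complex.exp_neg, Complex.exp_pi_div_two_mul_I, Complex.inv_I]
    rw [← this, ← Complex.exp_add]
    congr 1
    push_cast
    ring
  have h2 : Complex.exp (Complex.I * x) = Complex.exp (((x / 2 : ℝ) : ℂ) * Complex.I) ^ 2 := by
    rw [← Complex.exp_nat_mul]
    congr 1
    push_cast
    ring
  rw [h1, h2, Complex.exp_mul_I, ← Complex.ofReal_cos, ← Complex.ofReal_sin]
  have h3 : ((Real.cos (x / 2) : ℝ) : ℂ) ^ 2 = 1 - ((Real.sin (x / 2) : ℝ) : ℂ) ^ 2 := by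
    have := Real.cos_sq' (x / 2)
    exact_mod_cast this
  push_cast at h3 ⊢
  linear_combination (-1 : ℂ) * h3 + (Complex.sin (x / 2)) ^ 2 * Complex.I_sq

/-- The argument `(x - π)/2` lies in `(-π/2, π/2)`, so it is the principal one and the power just
multiplies it by `α`. -/
theorem cpow_one_sub_exp {x : ℝ} (hx : x ∈ Set.Ioo 0 (2 * Real.pi)) (α : ℝ) :
    (1 - Complex.exp (Complex.I * x)) ^ (α : ℂ) =
      (((2 * Real.sin (x / 2)) ^ α : ℝ) : ℂ) *
        Complex.exp ((α * ((x - Real.pi) / 2) : ℝ) * Complex.I) := by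
  have hs := two_sin_half_pos hx
  have hlog : 1 - Complex.exp (Complex.I * x) =
      Complex.exp ((Real.log (2 * Real.sin (x / 2)) : ℝ) +
        (((x - Real.pi) / 2 : ℝ) : ℂ) * Complex.I) := by
    rw [one_sub_exp_eq, Complex.exp_add, ← Complex.ofReal_exp, Real.exp_log hs]
  have him : ((Real.log (2 * Real.sin (x / 2)) : ℝ) +
        (((x - Real.pi) / 2 : ℝ) : ℂ) * Complex.I).im = (x - Real.pi) / 2 := by simp
  rw [hlog, Complex.cpow_def_of_ne_zero (Complex.exp_ne_zero _),
    Complex.log_exp (by rw [him]; linarith [hx.1, Real.pi_pos])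
      (by rw [him]; linarith [hx.2, Real.pi_pos]), add_mul, Complex.exp_add,
    Real.rpow_def_of_pos hs, Complex.ofReal_exp]
  congr 2 <;> push_cast <;> ring

/-- The sign `(-1)^{p+1}` and the shift recentre the phase at `x = π`: the argument of `-g` becomes
`(α/2 - p)(x - π)`, of modulus below `π/2` exactly because `2p - 1 < α < 2p + 1`. -/
theorem periodicSymbol_eq {x : ℝ} (hx : x ∈ Set.Ioo 0 (2 * Real.pi)) :
    periodicSymbol α p x = -(((2 * Real.sin (x / 2)) ^ α : ℝ) : ℂ) *
      Complex.exp (((α / 2 - p) * (x - Real.pi) : ℝ) * Complex.I) := by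
  have h1 : Complex.exp (-(Complex.I * p * x)) =
      (-1) ^ p * Complex.exp ((-p * (x - Real.pi) : ℝ) * Complex.I) := by
    have : ((-1 : ℂ)) ^ p = Complex.exp (-(p * (Real.pi * Complex.I))) := by
      rw [Complex.exp_neg, Complex.exp_nat_mul, Complex.exp_pi_mul_I, ← inv_pow]
      norm_num
    rw [this, ← Complex.exp_add]
    congr 1
    push_cast
    ring
  rw [periodicSymbol, cpow_one_sub_exp hx, h1]
  have h2 : Complex.exp (((α / 2 - p) * (x - Real.pi) : ℝ) * Complex.I) =
      Complex.exp ((-p * (x - Real.pi) : ℝ) * Complex.I) *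
        Complex.exp ((α * ((x - Real.pi) / 2) : ℝ) * Complex.I) := by
    rw [← Complex.exp_add]
    congr 1
    push_cast
    ring
  rw [h2]
  have h3 : ((-1 : ℂ)) ^ (p + 1) * (-1) ^ p = -1 := by
    rw [← pow_add, show p + 1 + p = 2 * p + 1 by ring, pow_succ, pow_mul]
    simp
  linear_combination (((2 * Real.sin (x / 2)) ^ α : ℝ) : ℂ) *
    Complex.exp ((-p * (x - Real.pi) : ℝ) * Complex.I) *
    Complex.exp ((α * ((x - Real.pi) / 2) : ℝ) * Complex.I) * h3

theorem norm_periodicSymbol {x : ℝ} (hx : x ∈ Set.Ioo 0 (2 * Real.pi)) :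
    ‖periodicSymbol α p x‖ = (2 * Real.sin (x / 2)) ^ α := by
  rw [periodicSymbol_eq hx, norm_mul, norm_neg, Complex.norm_real, Complex.norm_exp_ofReal_mul_I,
    mul_one, Real.norm_of_nonneg (Real.rpow_nonneg (two_sin_half_pos hx).le _)]

/-- The cosine of the half-opening of a sector that contains the values of `-g`. -/
def sectorConst (α : ℝ) (p : ℕ) : ℝ := Real.cos (|α / 2 - p| * Real.pi)

theorem sectorConst_pos (hp₁ : 2 * (p : ℝ) - 1 < α) (hp₂ : α < 2 * (p : ℝ) + 1) :
    0 < sectorConst α p := by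
  have h1 : |α / 2 - p| < 1 / 2 := by rw [abs_lt]; constructor <;> linarith
  have hpi := Real.pi_pos
  refine Real.cos_pos_of_mem_Ioo ⟨?_, ?_⟩
  · have : 0 ≤ |α / 2 - p| * Real.pi := by positivity
    linarith
  · nlinarith

theorem re_periodicSymbol_le (hp₁ : 2 * (p : ℝ) - 1 < α) (hp₂ : α < 2 * (p : ℝ) + 1) {x : ℝ}
    (hx : x ∈ Set.Ioo 0 (2 * Real.pi)) :
    (periodicSymbol α p x).re ≤ -sectorConst α p * (2 * Real.sin (x / 2)) ^ α := by
  rw [periodicSymbol_eq hx, neg_mul, Complex.neg_re, Complex.re_ofReal_mul,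
    Complex.exp_ofReal_mul_I_re, neg_mul, mul_comm (sectorConst α p)]
  refine neg_le_neg (mul_le_mul_of_nonneg_left ?_ (Real.rpow_nonneg (two_sin_half_pos hx).le _))
  have h1 : |α / 2 - p| < 1 / 2 := by rw [abs_lt]; constructor <;> linarith
  have h2 : |x - Real.pi| ≤ Real.pi := by rw [abs_le]; constructor <;> linarith [hx.1, hx.2]
  have hpi := Real.pi_pos
  rw [sectorConst, ← Real.cos_abs ((α / 2 - p) * (x - Real.pi)), abs_mul]
  refine Real.cos_le_cos_of_nonneg_of_le_pi (by positivity) ?_ (by gcongr)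
  nlinarith

/-- In `α + 1`, the `α` comes from the modulus and the `1` from the phase, through `s ≤ 2` and `|α/2
- p| < 1/2`. -/
theorem exists_hasDerivAt_periodicSymbol (hα : 0 < α) (hp₁ : 2 * (p : ℝ) - 1 < α)
    (hp₂ : α < 2 * (p : ℝ) + 1) {x : ℝ} (hx : x ∈ Set.Ioo 0 (2 * Real.pi)) :
    ∃ d : ℂ, HasDerivAt (periodicSymbol α p) d x ∧
      ‖d‖ ≤ (α + 1) * (2 * Real.sin (x / 2)) ^ (α - 1) := by
  have hs := two_sin_half_pos hx
  set s := 2 * Real.sin (x / 2) with hsdef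
  have hd1 : HasDerivAt (fun x : ℝ => 2 * Real.sin (x / 2)) (Real.cos (x / 2)) x := by
    have : HasDerivAt (fun x : ℝ => 2 * Real.sin (x / 2)) (2 * (Real.cos (x / 2) * (1 / 2))) x :=
      (((hasDerivAt_id x).div_const 2).sin).const_mul 2
    exact this.congr_deriv (by ring)
  have hd2 := (hd1.rpow_const (p := α) (Or.inl hs.ne')).ofReal_comp.neg
  have hd3 : HasDerivAt (fun x : ℝ => Complex.exp (((α / 2 - p) * (x - Real.pi) : ℝ) * Complex.I))
      (Complex.exp (((α / 2 - p) * (x - Real.pi) : ℝ) * Complex.I) *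
        (((α / 2 - p : ℝ) : ℂ) * Complex.I)) x := by
    have h1 : HasDerivAt (fun x : ℝ => (α / 2 - p) * (x - Real.pi)) (α / 2 - p) x := by
      simpa using ((hasDerivAt_id x).sub_const Real.pi).const_mul (α / 2 - p)
    exact (h1.ofReal_comp.mul_const Complex.I).cexp
  refine ⟨_, (hd2.mul hd3).congr_of_eventuallyEq ?_, ?_⟩
  · filter_upwards [Ioo_mem_nhds hx.1 hx.2] with y hy using periodicSymbol_eq hy
  · have h1 : |α / 2 - p| < 1 / 2 := by rw [abs_lt]; constructor <;> linarith
    refine (norm_add_le _ _).trans ?_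
    simp only [Pi.neg_apply, norm_mul, norm_neg, Complex.norm_real,
      Complex.norm_exp_ofReal_mul_I, Complex.norm_I, mul_one, one_mul, Real.norm_eq_abs]
    rw [← hsdef, abs_of_pos hα, abs_of_pos (Real.rpow_pos_of_pos hs _),
      abs_of_pos (Real.rpow_pos_of_pos hs _)]
    have h2 : s ^ α = s ^ (α - 1) * s := by
      rw [← Real.rpow_add_one hs.ne']; simp
    have h3 : s ≤ 2 := by have := Real.sin_le_one (x / 2); linarith
    have h4 : 0 < s ^ (α - 1) := Real.rpow_pos_of_pos hs _
    have h5 := Real.abs_cos_le_one (x / 2)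
    have h6 : |Real.cos (x / 2)| * α * s ^ (α - 1) ≤ 1 * α * s ^ (α - 1) := by gcongr
    have h7 : s ^ α * |α / 2 - p| ≤ s ^ (α - 1) * 2 * (1 / 2) := by
      rw [h2]; gcongr
    linarith

end

section

/-! ### Uniform bounds for the Grünwald semigroups -/

variable {α h : ℝ} {p : ℕ}

theorem norm_smul_grunwaldOp_le (hα : 0 < α) (p : ℕ) (hh : 0 < h) {t : ℝ} (ht : 0 ≤ t) :
    ‖(t : ℂ) • grunwaldOp α p h‖ ≤ t * h ^ (-α) * ∑' m, |coeff α m| := by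
  rw [norm_smul, Complex.norm_real, Real.norm_of_nonneg ht, mul_assoc, ← tsum_mul_left]
  refine mul_le_mul_of_nonneg_left ((norm_translationSeries_le
    (summable_norm_grunwaldCoeff hα p h)).trans (le_of_eq (tsum_congr fun m => ?_))) ht
  rw [Complex.norm_real, grunwaldCoeff, norm_mul, norm_mul, norm_pow, norm_neg, norm_one, one_pow,
    one_mul, Real.norm_of_nonneg (Real.rpow_nonneg hh.le _), Real.norm_eq_abs]

theorem hasSymbol_of_fourier_hasSum {a : ℤ → ℂ} {F : ℝ → ℂ} (ha : Summable fun n => ‖a n‖)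
    (hF : ∀ x : ℝ, HasSum (fun n => a n * Complex.exp (Complex.I * n * x)) (F x)) (h : ℝ) :
    HasSymbol (translationSeries a fun n : ℤ => n * h) fun k => F (k * h) :=
  hasSymbol_translationSeries ha fun k => (hF (k * h)).congr_fun fun n => by
    push_cast
    ring_nf

theorem smul_symbol_eq (α : ℝ) (p : ℕ) (h t k : ℝ) :
    (t : ℂ) * symbol α p h k = ((t * h ^ (-α) : ℝ) : ℂ) * periodicSymbol α p (k * h) := by
  rw [symbol_eq]
  push_cast
  ring

theorem hasSymbol_smul_mul_exp (hα : 0 < α) (p : ℕ) (h t : ℝ) :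
    HasSymbol (((t : ℂ) • grunwaldOp α p h) * NormedSpace.exp ((t : ℂ) • grunwaldOp α p h))
      fun k => t * symbol α p h k * Complex.exp (t * symbol α p h k) :=
  ((hasSymbol_grunwaldOp hα p h).smul t).mul (hasSymbol_exp_grunwaldOp hα p h t)

/-- Fourier coefficients of `exp(τ g)` and `τ g exp(τ g)`, uniformly in `τ ≥ 1`. -/
theorem exists_fourier_bound_exp_periodicSymbol (hα : 1 / 2 < α) (hp₁ : 2 * (p : ℝ) - 1 < α)
    (hp₂ : α < 2 * (p : ℝ) + 1) :
    ∃ K : ℝ, ∀ τ : ℝ, 1 ≤ τ →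
      (∃ a : ℤ → ℂ, (Summable fun n => ‖a n‖) ∧ ∑' n, ‖a n‖ ≤ K ∧
        ∀ x : ℝ, HasSum (fun n => a n * Complex.exp (Complex.I * n * x))
          (Complex.exp (τ * periodicSymbol α p x))) ∧
      (∃ a : ℤ → ℂ, (Summable fun n => ‖a n‖) ∧ ∑' n, ‖a n‖ ≤ K ∧
        ∀ x : ℝ, HasSum (fun n => a n * Complex.exp (Complex.I * n * x))
          (τ * periodicSymbol α p x * Complex.exp (τ * periodicSymbol α p x))) := by
  have hα0 : 0 < α := by linarith
  have hc := sectorConst_pos hp₁ hp₂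
  set c := sectorConst α p with hcdef
  obtain ⟨K, hK⟩ := exists_fourier_bound hα hc
  refine ⟨K, fun τ hτ => ?_⟩
  have hτ0 : 0 < τ := by linarith
  -- The natural length scale: `τ s^α = (l s)^α`.
  set l := τ ^ α⁻¹ with hl
  have hl1 : 1 ≤ l := Real.one_le_rpow hτ (by positivity)
  have hl0 : 0 < l := by linarith
  have hlα : l ^ α = τ := by rw [hl, ← Real.rpow_mul hτ0.le, inv_mul_cancel₀ hα0.ne', Real.rpow_one]
  have hcont := continuous_periodicSymbol hα0 p
  have hper := periodic_periodicSymbol α p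
  set g := periodicSymbol α p with hg
  have hd : ∀ x ∈ Set.Ioo 0 (2 * Real.pi), HasDerivAt g (deriv g x) x ∧
      ‖(τ : ℂ) * deriv g x‖ ≤ (α + 1) * l * (l * (2 * Real.sin (x / 2))) ^ (α - 1) := by
    intro x hx
    obtain ⟨d, hd1, hd2⟩ := exists_hasDerivAt_periodicSymbol hα0 hp₁ hp₂ hx
    have hs := two_sin_half_pos hx
    refine ⟨hd1.differentiableAt.hasDerivAt, ?_⟩
    rw [hd1.deriv, norm_mul, Complex.norm_real, Real.norm_of_nonneg hτ0.le]
    refine (mul_le_mul_of_nonneg_left hd2 hτ0.le).trans (le_of_eq ?_)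
    have h1 : τ = l ^ (α - 1) * l := by
      rw [← Real.rpow_add_one hl0.ne', sub_add_cancel, hlα]
    rw [Real.mul_rpow hl0.le hs.le]
    nth_rewrite 1 [h1]
    ring
  have hu : ∀ x ∈ Set.Ioo 0 (2 * Real.pi),
      ‖(τ : ℂ) * g x‖ = (l * (2 * Real.sin (x / 2))) ^ α := by
    intro x hx
    rw [norm_mul, Complex.norm_real, Real.norm_of_nonneg hτ0.le, norm_periodicSymbol hx,
      Real.mul_rpow hl0.le (two_sin_half_pos hx).le, hlα]
  have he : ∀ x ∈ Set.Ioo 0 (2 * Real.pi), ‖Complex.exp (τ * g x)‖ ≤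
      Real.exp (-c * (l * (2 * Real.sin (x / 2))) ^ α) := by
    intro x hx
    rw [Complex.norm_exp, Complex.re_ofReal_mul, Real.mul_rpow hl0.le (two_sin_half_pos hx).le, hlα]
    refine Real.exp_le_exp.2 ?_
    have := mul_le_mul_of_nonneg_left (re_periodicSymbol_le hp₁ hp₂ hx) hτ0.le
    linarith
  have hunn : ∀ x ∈ Set.Ioo 0 (2 * Real.pi), 0 ≤ (l * (2 * Real.sin (x / 2))) ^ α := fun x hx =>
    (norm_nonneg _).trans (hu x hx).le
  constructor
  · refine hK l _ (fun x => Complex.exp (τ * g x) * (τ * deriv g x)) hl1 (by fun_prop)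
      (fun x => by simp only [hper x]) (fun x hx => ((hd x hx).1.const_mul (τ : ℂ)).cexp)
      (fun x hx => ?_) (fun x hx => ?_)
    · refine (he x hx).trans (le_mul_of_one_le_left (Real.exp_nonneg _) ?_)
      linarith [hunn x hx]
    · rw [norm_mul, mul_comm ‖_‖]
      refine mul_le_mul (hd x hx).2 ((he x hx).trans ?_) (norm_nonneg _)
        ((norm_nonneg _).trans (hd x hx).2)
      refine le_mul_of_one_le_left (Real.exp_nonneg _) ?_
      linarith [hunn x hx]
  · refine hK l _ (fun x => τ * deriv g x * Complex.exp (τ * g x) +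
      τ * g x * (Complex.exp (τ * g x) * (τ * deriv g x))) hl1 (by fun_prop)
      (fun x => by simp only [hper x]) (fun x hx => ((hd x hx).1.const_mul (τ : ℂ)).mul
        ((hd x hx).1.const_mul (τ : ℂ)).cexp) (fun x hx => ?_) (fun x hx => ?_)
    · rw [norm_mul, hu x hx]
      refine mul_le_mul (by linarith) (he x hx) (norm_nonneg _) ?_
      linarith [hunn x hx]
    · have h1 : (τ : ℂ) * deriv g x * Complex.exp (τ * g x) +
          τ * g x * (Complex.exp (τ * g x) * (τ * deriv g x)) =
          τ * deriv g x * ((1 + τ * g x) * Complex.exp (τ * g x)) := by ring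
      rw [h1, norm_mul (_ * _) (_ * _), norm_mul (1 + _)]
      refine mul_le_mul (hd x hx).2 (mul_le_mul ?_ (he x hx) (norm_nonneg _) ?_) (by positivity)
        ((norm_nonneg _).trans (hd x hx).2)
      · refine (norm_add_le _ _).trans ?_
        rw [norm_one, hu x hx]
      · linarith [hunn x hx]

/-- Uniform boundedness and analyticity of the Grünwald semigroups for `α > 1/2`. -/
theorem exists_bound_of_half_lt (hα : 1 / 2 < α) (hp₁ : 2 * (p : ℝ) - 1 < α)
    (hp₂ : α < 2 * (p : ℝ) + 1) :
    ∃ K : ℝ, ∀ h t : ℝ, 0 < h → 0 ≤ t →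
      ‖NormedSpace.exp ((t : ℂ) • grunwaldOp α p h)‖ ≤ K ∧
      ‖((t : ℂ) • grunwaldOp α p h) * NormedSpace.exp ((t : ℂ) • grunwaldOp α p h)‖ ≤ K := by
  have hα0 : 0 < α := by linarith
  obtain ⟨K, hK⟩ := exists_fourier_bound_exp_periodicSymbol hα hp₁ hp₂
  set A := ∑' m, |coeff α m| with hA
  have hA0 : 0 ≤ A := tsum_nonneg fun _ => abs_nonneg _
  refine ⟨max K ((1 + A) * Real.exp A), fun h t hh ht => ?_⟩
  set τ := t * h ^ (-α) with hτ
  rcases le_total 1 τ with h1 | h1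
  · obtain ⟨⟨a, ha, haK, hasum⟩, b, hb, hbK, hbsum⟩ := hK τ h1
    have e1 := (hasSymbol_of_fourier_hasSum ha hasum h).congr fun k => by
      rw [← smul_symbol_eq]
    have e2 := (hasSymbol_of_fourier_hasSum hb hbsum h).congr fun k => by
      rw [← smul_symbol_eq]
    rw [(hasSymbol_smul_mul_exp hα0 p h t).unique e2, (hasSymbol_exp_grunwaldOp hα0 p h t).unique e1]
    exact ⟨((norm_translationSeries_le ha).trans haK).trans (le_max_left _ _),
      ((norm_translationSeries_le hb).trans hbK).trans (le_max_left _ _)⟩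
  -- For `τ ≤ 1` the generator itself satisfies `‖tB‖ ≤ A`, and the exponential series suffices.
  · have hB : ‖(t : ℂ) • grunwaldOp α p h‖ ≤ A :=
      (norm_smul_grunwaldOp_le hα0 p hh ht).trans (mul_le_of_le_one_left hA0 h1)
    have hE : ‖NormedSpace.exp ((t : ℂ) • grunwaldOp α p h)‖ ≤ Real.exp A :=
      (norm_exp_le_exp_norm _).trans (Real.exp_le_exp.2 hB)
    refine ⟨(hE.trans ?_).trans (le_max_right _ _), ((norm_mul_le _ _).trans ?_).trans
      (le_max_right _ _)⟩
    · exact le_mul_of_one_le_left (Real.exp_nonneg _) (by linarith)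
    · exact mul_le_mul (by linarith) hE (norm_nonneg _) (by linarith)

end

section

/-! ### Gaussian subordination -/

theorem integrableOn_one_add_mul_exp_neg_sq :
    IntegrableOn (fun x : ℝ => (1 + 2 * x ^ 2) * Real.exp (-x ^ 2)) (Set.Ioi 0) := by
  have h1 := (integrable_exp_neg_mul_sq (b := 1) one_pos).integrableOn (s := Set.Ioi 0)
  have h2 := integrableOn_rpow_mul_exp_neg_mul_sq (b := 1) one_pos (s := 2) (by norm_num)
  refine (h1.add (h2.const_mul 2)).congr_fun (fun x _ => ?_) measurableSet_Ioi
  simp only [neg_one_mul, Real.rpow_two, Pi.add_apply]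
  ring

theorem integrableOn_gaussian_inv (c : ℝ) :
    IntegrableOn (fun x : ℝ => Real.exp (-x ^ 2 - c ^ 2 / x ^ 2)) (Set.Ioi 0) := by
  have h1 := (integrable_exp_neg_mul_sq (b := 1) one_pos).integrableOn (s := Set.Ioi 0)
  refine Integrable.mono' h1 (by fun_prop) (Eventually.of_forall fun x => ?_)
  rw [Real.norm_of_nonneg (Real.exp_nonneg _)]
  refine Real.exp_le_exp.2 ?_
  have : 0 ≤ c ^ 2 / x ^ 2 := by positivity
  linarith

/-! ### The substitutions `x ↦ c / x` and `x ↦ x - c / x` -/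

section Inversion

variable {c : ℝ}

theorem image_div_Ioi (hc : 0 < c) : (fun x : ℝ => c / x) '' Set.Ioi 0 = Set.Ioi 0 := by
  ext y
  constructor
  · rintro ⟨x, hx, rfl⟩
    exact div_pos hc hx
  · intro hy
    exact ⟨c / y, div_pos hc hy, by
      have : y ≠ 0 := ne_of_gt hy
      field_simp⟩

theorem injOn_div_Ioi (hc : 0 < c) : Set.InjOn (fun x : ℝ => c / x) (Set.Ioi 0) := by
  intro x hx y hy hxy
  have hx' : x ≠ 0 := ne_of_gt hx
  have hy' : y ≠ 0 := ne_of_gt hy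
  have h : c / x = c / y := hxy
  field_simp at h
  exact h.symm

theorem hasDerivAt_const_div {x : ℝ} (hx : x ≠ 0) (c : ℝ) :
    HasDerivAt (fun x : ℝ => c / x) (-(c / x ^ 2)) x := by
  have := (hasDerivAt_inv hx).const_mul c
  simp only [← div_eq_mul_inv] at this
  exact this.congr_deriv (by ring)

theorem abs_deriv_smul_gaussian_inv (hc : 0 < c) {x : ℝ} (hx : x ∈ Set.Ioi (0 : ℝ)) :
    |(-(c / x ^ 2))| • Real.exp (-(c / x) ^ 2 - c ^ 2 / (c / x) ^ 2) =
      c / x ^ 2 * Real.exp (-x ^ 2 - c ^ 2 / x ^ 2) := by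
  have hx' : x ≠ 0 := ne_of_gt hx
  rw [abs_neg, abs_of_pos (div_pos hc (by positivity)), smul_eq_mul]
  congr 2
  field_simp
  ring

theorem integrableOn_div_sq_mul_gaussian_inv (hc : 0 < c) :
    IntegrableOn (fun x : ℝ => c / x ^ 2 * Real.exp (-x ^ 2 - c ^ 2 / x ^ 2)) (Set.Ioi 0) := by
  have h := integrableOn_gaussian_inv c
  rw [← image_div_Ioi hc, integrableOn_image_iff_integrableOn_abs_deriv_smul measurableSet_Ioi
    (fun x hx => (hasDerivAt_const_div (ne_of_gt hx) c).hasDerivWithinAt) (injOn_div_Ioi hc)] at h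
  exact h.congr_fun (fun x hx => abs_deriv_smul_gaussian_inv hc hx) measurableSet_Ioi

/-- The substitution `x ↦ c / x` exchanges `x²` and `c² / x²` and has Jacobian `c / x²`. -/
theorem integral_div_sq_mul_gaussian_inv (hc : 0 < c) :
    ∫ x in Set.Ioi 0, c / x ^ 2 * Real.exp (-x ^ 2 - c ^ 2 / x ^ 2) =
      ∫ x in Set.Ioi 0, Real.exp (-x ^ 2 - c ^ 2 / x ^ 2) := by
  conv_rhs => rw [← image_div_Ioi hc]
  rw [integral_image_eq_integral_abs_deriv_smul measurableSet_Ioi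
    (fun x hx => (hasDerivAt_const_div (ne_of_gt hx) c).hasDerivWithinAt) (injOn_div_Ioi hc)]
  exact setIntegral_congr_fun measurableSet_Ioi
    fun x hx => (abs_deriv_smul_gaussian_inv hc hx).symm

theorem image_sub_div_Ioi (hc : 0 < c) : (fun x : ℝ => x - c / x) '' Set.Ioi 0 = Set.univ := by
  refine Set.eq_univ_of_forall fun y => ?_
  have h0 : 0 < y ^ 2 + 4 * c := by positivity
  have h1 : |y| < √(y ^ 2 + 4 * c) := by
    rw [← Real.sqrt_sq_eq_abs]
    exact Real.sqrt_lt_sqrt (sq_nonneg y) (by linarith)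
  have h2 : 0 < y + √(y ^ 2 + 4 * c) := by linarith [neg_abs_le y]
  -- The positive root of `x² - yx - c = 0`.
  refine ⟨(y + √(y ^ 2 + 4 * c)) / 2, by simpa using h2, ?_⟩
  have h3 := Real.sq_sqrt h0.le
  simp only
  field_simp
  linear_combination h3

theorem injOn_sub_div_Ioi (hc : 0 < c) : Set.InjOn (fun x : ℝ => x - c / x) (Set.Ioi 0) := by
  refine StrictMonoOn.injOn fun x hx y hy hxy => ?_
  have : c / y < c / x := div_lt_div_of_pos_left hc hx hxy
  exact sub_lt_sub hxy this

/-- The Cauchy–Schlömilch substitution. -/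
theorem integral_gaussian_inv (hc : 0 < c) :
    ∫ x in Set.Ioi 0, Real.exp (-x ^ 2 - c ^ 2 / x ^ 2) = √Real.pi / 2 * Real.exp (-(2 * c)) := by
  have h1 : ∫ u : ℝ, Real.exp (-u ^ 2) = √Real.pi := by
    simpa using integral_gaussian 1
  have hd : ∀ x ∈ Set.Ioi (0 : ℝ), HasDerivWithinAt (fun x : ℝ => x - c / x) (1 - -(c / x ^ 2))
      (Set.Ioi 0) x := fun x hx =>
    ((hasDerivAt_id x).sub (hasDerivAt_const_div (ne_of_gt hx) c)).hasDerivWithinAt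
  rw [← setIntegral_univ, ← image_sub_div_Ioi hc,
    integral_image_eq_integral_abs_deriv_smul measurableSet_Ioi
    (f' := fun x => 1 - -(c / x ^ 2)) hd (injOn_sub_div_Ioi hc)] at h1
  -- Here `-(x - c/x)² = 2c - x² - c²/x²`, and the two terms of the Jacobian contribute equal
  -- integrals.
  have h2 : ∫ x in Set.Ioi 0, |1 - -(c / x ^ 2)| • Real.exp (-(x - c / x) ^ 2) =
      ∫ x in Set.Ioi 0, Real.exp (2 * c) * (Real.exp (-x ^ 2 - c ^ 2 / x ^ 2) +
        c / x ^ 2 * Real.exp (-x ^ 2 - c ^ 2 / x ^ 2)) := by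
    refine setIntegral_congr_fun measurableSet_Ioi fun x hx => ?_
    have hx' : x ≠ 0 := ne_of_gt hx
    have h3 : -(x - c / x) ^ 2 = 2 * c + (-x ^ 2 - c ^ 2 / x ^ 2) := by
      field_simp
      ring
    have h4 : 0 ≤ c / x ^ 2 := by positivity
    rw [sub_neg_eq_add, abs_of_nonneg (by linarith), h3, Real.exp_add, smul_eq_mul]
    ring
  rw [h2, integral_const_mul, integral_add (integrableOn_gaussian_inv c)
    (integrableOn_div_sq_mul_gaussian_inv hc), integral_div_sq_mul_gaussian_inv hc] at h1
  have h5 : Real.exp (2 * c) * Real.exp (-(2 * c)) = 1 := by rw [← Real.exp_add]; simp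
  linear_combination (Real.exp (-(2 * c)) / 2) * h1 -
    (∫ x in Set.Ioi 0, Real.exp (-x ^ 2 - c ^ 2 / x ^ 2)) * h5

end Inversion

theorem integrableOn_sq_sub_one_mul_gaussian_inv (c : ℝ) :
    IntegrableOn (fun x : ℝ => (2 * x ^ 2 - 1) * Real.exp (-x ^ 2 - c ^ 2 / x ^ 2))
      (Set.Ioi 0) := by
  refine Integrable.mono' integrableOn_one_add_mul_exp_neg_sq (by fun_prop)
    (Eventually.of_forall fun x => ?_)
  rw [norm_mul, Real.norm_of_nonneg (Real.exp_nonneg _), Real.norm_eq_abs]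
  have h1 : |2 * x ^ 2 - 1| ≤ 1 + 2 * x ^ 2 := by
    rw [abs_le]; constructor <;> nlinarith [sq_nonneg x]
  have h2 : Real.exp (-x ^ 2 - c ^ 2 / x ^ 2) ≤ Real.exp (-x ^ 2) := by
    refine Real.exp_le_exp.2 ?_
    have : 0 ≤ c ^ 2 / x ^ 2 := by positivity
    linarith
  gcongr

/-- Integration by parts for the derivative of `x exp(-x² - c²/x²)`. -/
theorem integral_sq_sub_one_mul_gaussian_inv {c : ℝ} (hc : 0 ≤ c) :
    ∫ x in Set.Ioi 0, (2 * x ^ 2 - 1) * Real.exp (-x ^ 2 - c ^ 2 / x ^ 2) =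
      √Real.pi / 2 * (2 * c * Real.exp (-(2 * c))) := by
  have hint : IntegrableOn (fun x : ℝ => 2 * c * (c / x ^ 2 * Real.exp (-x ^ 2 - c ^ 2 / x ^ 2)))
      (Set.Ioi 0) := by
    -- The inversion requires `c > 0`; `c = 0` is kept because it supplies the formula at `v = 0`.
    rcases hc.eq_or_lt with rfl | hc
    · simp
    · exact (integrableOn_div_sq_mul_gaussian_inv hc).const_mul _
  have hle : ∀ x : ℝ, Real.exp (-x ^ 2 - c ^ 2 / x ^ 2) ≤ Real.exp (-x ^ 2) := fun x => by
    refine Real.exp_le_exp.2 ?_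
    have : 0 ≤ c ^ 2 / x ^ 2 := by positivity
    linarith
  have hlim0 : ContinuousWithinAt (fun x : ℝ => x * Real.exp (-x ^ 2 - c ^ 2 / x ^ 2))
      (Set.Ici 0) 0 := by
    have : Tendsto (fun x : ℝ => x * Real.exp (-x ^ 2 - c ^ 2 / x ^ 2)) (𝓝 0) (𝓝 0) := by
      refine squeeze_zero_norm (fun x => ?_) (tendsto_norm_zero (E := ℝ))
      rw [norm_mul, Real.norm_of_nonneg (Real.exp_nonneg _)]
      refine mul_le_of_le_one_right (norm_nonneg _) ((hle x).trans ?_)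
      rw [Real.exp_le_one_iff]
      nlinarith
    simpa [ContinuousWithinAt] using this.mono_left nhdsWithin_le_nhds
  have hlim : Tendsto (fun x : ℝ => x * Real.exp (-x ^ 2 - c ^ 2 / x ^ 2)) atTop (𝓝 0) := by
    have h1 := (Real.tendsto_pow_mul_exp_neg_atTop_nhds_zero 1)
    refine squeeze_zero' ?_ ?_ h1
    · filter_upwards [eventually_ge_atTop 0] with x hx
      positivity
    · filter_upwards [eventually_ge_atTop 1] with x hx
      rw [pow_one]
      refine mul_le_mul_of_nonneg_left ((hle x).trans (Real.exp_le_exp.2 ?_)) (by linarith)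
      nlinarith
  have hderiv : ∀ x ∈ Set.Ioi (0 : ℝ), HasDerivAt
      (fun x : ℝ => x * Real.exp (-x ^ 2 - c ^ 2 / x ^ 2))
      (2 * c * (c / x ^ 2 * Real.exp (-x ^ 2 - c ^ 2 / x ^ 2)) -
        (2 * x ^ 2 - 1) * Real.exp (-x ^ 2 - c ^ 2 / x ^ 2)) x := by
    intro x hx
    have hx' : x ≠ 0 := ne_of_gt hx
    have h1 : HasDerivAt (fun x : ℝ => -x ^ 2 - c ^ 2 / x ^ 2)
        (-(2 * x) + 2 * c ^ 2 / x ^ 3) x := by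
      have h2 := (hasDerivAt_pow 2 x)
      have h3 := h2.neg.sub ((hasDerivAt_const x (c ^ 2)).div h2 (by positivity))
      refine h3.congr_deriv ?_
      norm_num
      field_simp
      ring
    refine ((hasDerivAt_id x).mul h1.exp).congr_deriv ?_
    simp only [id]
    field_simp
    ring
  have h := integral_Ioi_of_hasDerivAt_of_tendsto hlim0 hderiv
    (hint.sub (integrableOn_sq_sub_one_mul_gaussian_inv c)) hlim
  rw [integral_sub hint (integrableOn_sq_sub_one_mul_gaussian_inv c), zero_mul, sub_zero,
    sub_eq_zero, integral_const_mul] at h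
  rw [← h]
  rcases hc.eq_or_lt with rfl | hc
  · simp
  · rw [integral_div_sq_mul_gaussian_inv hc, integral_gaussian_inv hc]
    ring

/-- Laplace-type integrals are holomorphic in the right half plane. -/
theorem differentiableOn_integral_exp_neg_mul {q r : ℝ → ℝ} {μ : Measure ℝ} (hq : Integrable q μ)
    (hr : Measurable r) (hr0 : ∀ x, 0 ≤ r x) :
    DifferentiableOn ℂ (fun w : ℂ => ∫ x, (q x : ℂ) * Complex.exp (-(w * r x)) ∂μ)
      {w : ℂ | 0 < w.re} := by
  intro w₀ hw₀
  have hw₀' : 0 < w₀.re := hw₀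
  -- Differentiation brings down the possibly unbounded `r`; since `r e^{-δ r} ≤ 1/δ`, the
  -- dominating function is still `|q| / δ`.
  set δ := w₀.re / 2 with hδ
  have hδ0 : 0 < δ := by positivity
  have hs : {w : ℂ | δ < w.re} ∈ 𝓝 w₀ :=
    (isOpen_lt continuous_const Complex.continuous_re).mem_nhds (by
      change δ < w₀.re
      linarith)
  have hqm : AEStronglyMeasurable (fun x => (q x : ℂ)) μ := hq.ofReal.aestronglyMeasurable
  have hem : ∀ w : ℂ, Measurable fun x => Complex.exp (-(w * r x)) := fun w => by fun_prop
  have hnorm : ∀ (w : ℂ) (x : ℝ), ‖Complex.exp (-(w * r x))‖ = Real.exp (-(w.re * r x)) :=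
    fun w x => by simp [Complex.norm_exp]
  refine (hasDerivAt_integral_of_dominated_loc_of_deriv_le (𝕜 := ℂ) (bound := fun x => |q x| / δ)
    (F' := fun w x => (q x : ℂ) * (Complex.exp (-(w * r x)) * (-(1 * r x)))) hs
    (Eventually.of_forall fun w => hqm.mul (hem w).aestronglyMeasurable) ?_
    (hqm.mul ((hem w₀).mul (by fun_prop)).aestronglyMeasurable)
    (Eventually.of_forall fun x w hw => ?_) (hq.abs.div_const δ)
    (Eventually.of_forall fun x w hw => ?_)).2.differentiableAt.differentiableWithinAt
  · refine hq.ofReal.mul_bdd (c := 1) (hem w₀).aestronglyMeasurable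
      (Eventually.of_forall fun x => ?_)
    rw [hnorm, Real.exp_le_one_iff, neg_nonpos]
    exact mul_nonneg hw₀'.le (hr0 x)
  · have hw' : δ < w.re := hw
    rw [norm_mul, norm_mul, hnorm, norm_neg, one_mul, Complex.norm_real, Complex.norm_real,
      Real.norm_eq_abs, Real.norm_of_nonneg (hr0 x), div_eq_mul_inv]
    refine mul_le_mul_of_nonneg_left ?_ (abs_nonneg _)
    have h1 : Real.exp (-(w.re * r x)) ≤ Real.exp (-(δ * r x)) := by
      have := hr0 x
      gcongr
    have h2 : δ * r x * Real.exp (-(δ * r x)) ≤ 1 := by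
      have h3 : δ * r x ≤ Real.exp (δ * r x) := by linarith [Real.add_one_le_exp (δ * r x)]
      calc δ * r x * Real.exp (-(δ * r x)) ≤ Real.exp (δ * r x) * Real.exp (-(δ * r x)) := by
            gcongr
        _ = 1 := by rw [← Real.exp_add]; simp
    calc Real.exp (-(w.re * r x)) * r x ≤ Real.exp (-(δ * r x)) * r x :=
          mul_le_mul_of_nonneg_right h1 (hr0 x)
      _ = δ⁻¹ * (δ * r x * Real.exp (-(δ * r x))) := by field_simp
      _ ≤ δ⁻¹ * 1 := by gcongr
      _ = δ⁻¹ := mul_one _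
  · exact ((((hasDerivAt_id w).mul_const (r x : ℂ)).neg).cexp).const_mul (q x : ℂ)

/-- The signed density in the subordination formula for `v exp(-v)`. -/
def subordinator (x : ℝ) : ℝ := (2 * x ^ 2 - 1) * Real.exp (-x ^ 2)

theorem integrableOn_subordinator : IntegrableOn subordinator (Set.Ioi 0) := by
  have h : subordinator = fun x => (2 * x ^ 2 - 1) * Real.exp (-x ^ 2) := rfl
  simpa [h] using integrableOn_sq_sub_one_mul_gaussian_inv 0

theorem integral_subordinator_of_nonneg {v : ℝ} (hv : 0 ≤ v) :
    ∫ x in Set.Ioi 0, (subordinator x : ℂ) * Complex.exp (-((v : ℂ) ^ 2 * (1 / (4 * x ^ 2) : ℝ))) =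
      (√Real.pi / 2 : ℝ) * (v * Complex.exp (-v)) := by
  have h := integral_sq_sub_one_mul_gaussian_inv (c := v / 2) (by positivity)
  have h2 := congrArg (fun r : ℝ => (r : ℂ)) h
  rw [← integral_complex_ofReal] at h2
  convert h2 using 1
  · refine setIntegral_congr_fun measurableSet_Ioi fun x hx => ?_
    simp only [subordinator]
    have : -x ^ 2 - (v / 2) ^ 2 / x ^ 2 = -x ^ 2 + -(v ^ 2 * (1 / (4 * x ^ 2))) := by ring
    rw [this, Real.exp_add]
    push_cast
    ring
  · rw [show 2 * (v / 2) = v by ring]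
    push_cast
    ring

/-- Gaussian subordination: `v exp(-v)` as an integral of `exp(-s v²)` over `s = 1 / (4x²)`. -/
theorem integral_subordinator {v : ℂ} (hv : 0 < v.re) (hv2 : 0 < (v ^ 2).re) :
    ∫ x in Set.Ioi 0, (subordinator x : ℂ) * Complex.exp (-(v ^ 2 * (1 / (4 * x ^ 2) : ℝ))) =
      (√Real.pi / 2 : ℝ) * (v * Complex.exp (-v)) := by
  set U : Set ℂ := {w : ℂ | 0 < w.re}
  have hUo : IsOpen U := isOpen_lt continuous_const Complex.continuous_re
  have hUc : IsPreconnected U := (convex_halfSpace_re_gt 0).isPreconnected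
  have hf := (differentiableOn_integral_exp_neg_mul integrableOn_subordinator
    (r := fun x => 1 / (4 * x ^ 2)) (by fun_prop) (fun x => by positivity)).analyticOnNhd hUo
  have hroot : DifferentiableOn ℂ (fun w : ℂ => w ^ (2⁻¹ : ℂ)) U := fun w hw =>
    (DifferentiableAt.cpow_const differentiableAt_id (Or.inl hw)).differentiableWithinAt
  have hg : AnalyticOnNhd ℂ (fun w : ℂ => ((√Real.pi / 2 : ℝ) : ℂ) *
      (w ^ (2⁻¹ : ℂ) * Complex.exp (-w ^ (2⁻¹ : ℂ)))) U :=
    (((hroot.mul hroot.neg.cexp)).const_mul _).analyticOnNhd hUo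
  -- Identity theorem in `w = v²`: both sides are analytic on the right half plane and agree at real
  -- `w` near `1`. The principal root of `v²` is `v` because `0 < v.re`.
  have hfg : ∃ᶠ w in 𝓝[≠] (1 : ℂ),
      ∫ x in Set.Ioi 0, (subordinator x : ℂ) * Complex.exp (-(w * (1 / (4 * x ^ 2) : ℝ))) =
      (√Real.pi / 2 : ℝ) * (w ^ (2⁻¹ : ℂ) * Complex.exp (-w ^ (2⁻¹ : ℂ))) := by
    have ht : Tendsto (fun x : ℝ => (x : ℂ)) (𝓝[≠] 1) (𝓝[≠] (1 : ℂ)) := by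
      refine tendsto_nhdsWithin_iff.2 ⟨?_, ?_⟩
      · exact (Complex.continuous_ofReal.tendsto' 1 1 (by simp)).mono_left nhdsWithin_le_nhds
      · filter_upwards [self_mem_nhdsWithin] with x hx
        simpa using hx
    refine ht.frequently (Eventually.frequently ?_)
    have : ∀ᶠ x : ℝ in 𝓝[≠] 1, 0 < x := nhdsWithin_le_nhds (lt_mem_nhds one_pos)
    filter_upwards [this] with x hx
    have h1 := integral_subordinator_of_nonneg (Real.sqrt_nonneg x)
    have h2 : ((√x : ℝ) : ℂ) ^ 2 = x := by
      rw [← Complex.ofReal_pow, Real.sq_sqrt hx.le]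
    have h3 : ((√x : ℝ) : ℂ) = (x : ℂ) ^ (2⁻¹ : ℂ) := by
      rw [← h2, Complex.sq_cpow_two_inv]
      simpa using hx
    rw [h2, h3] at h1
    exact h1
  have h := AnalyticOnNhd.eqOn_of_preconnected_of_frequently_eq hf hg hUc (z₀ := 1)
    (by simp) hfg (show v ^ 2 ∈ U from hv2)
  simp only [Complex.sq_cpow_two_inv hv] at h
  exact h

end

section

/-! ### Analyticity for small exponents by subordination -/

theorem norm_exp_grunwaldOp_zero_le_one {β : ℝ} (h0 : 0 < β) (h1 : β ≤ 1) {h : ℝ}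
    (hh : 0 < h) {s : ℝ} (hs : 0 ≤ s) :
    ‖NormedSpace.exp ((s : ℂ) • grunwaldOp β 0 h)‖ ≤ 1 :=
  norm_exp_grunwaldOp_le_one h0 (fun _ hm => grunwaldCoeff_nonneg_of_le_one h0 h1 hh hm) hs

theorem re_cpow_pos {z : ℂ} (hz : 0 < z.re) {β : ℝ} (h0 : 0 ≤ β) (h1 : β ≤ 1) :
    0 < (z ^ (β : ℂ)).re := by
  have hz0 : z ≠ 0 := by
    rintro rfl
    simp at hz
  have harg := abs_lt.1 (Complex.abs_arg_lt_pi_div_two_iff.2 (Or.inl hz))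
  rw [Complex.cpow_def_of_ne_zero hz0, Complex.exp_re]
  refine mul_pos (Real.exp_pos _) (Real.cos_pos_of_mem_Ioo ?_)
  have him : (Complex.log z * β).im = z.arg * β := by
    rw [Complex.im_mul_ofReal, Complex.log_im]
  rw [him]
  have hpi := Real.pi_pos
  constructor
  · nlinarith [harg.1, harg.2]
  · nlinarith [harg.1, harg.2]

theorem re_one_sub_pos {z : ℂ} (hz : ‖z‖ ≤ 1) (h1 : z ≠ 1) : 0 < (1 - z).re := by
  refine lt_of_le_of_ne (re_one_sub_nonneg hz) fun h => h1 ?_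
  have hre : z.re = 1 := by
    rw [Complex.sub_re, Complex.one_re] at h
    linarith
  have h2 := Complex.sq_norm z
  rw [Complex.normSq_apply, hre] at h2
  have h3 : z.im = 0 := by
    have : ‖z‖ ^ 2 ≤ 1 := pow_le_one₀ (norm_nonneg _) hz
    nlinarith
  exact Complex.ext hre h3

variable {α h : ℝ}

theorem symbol_zero_eq (α h k : ℝ) : symbol α 0 h k =
    -(((h ^ (-α) : ℝ) : ℂ) * (1 - Complex.exp (Complex.I * k * h)) ^ (α : ℂ)) := by
  simp [symbol]

/-- The subordination formula relating the symbols of order `2α` and `α`. -/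
theorem integral_subordinator_symbol (h0 : 0 < α) (h1 : α ≤ 1 / 2) (hh : 0 < h) {t : ℝ}
    (ht : 0 ≤ t) (k : ℝ) :
    ∫ x in Set.Ioi 0, (subordinator x : ℂ) *
        Complex.exp ((t ^ 2 / (4 * x ^ 2) : ℝ) * symbol (2 * α) 0 h k) =
      (√Real.pi / 2 : ℝ) * -(t * symbol α 0 h k * Complex.exp (t * symbol α 0 h k)) := by
  set v : ℂ := -(t * symbol α 0 h k) with hv
  have hz : ‖Complex.exp (Complex.I * k * h)‖ ≤ 1 := by
    rw [show Complex.I * k * h = ((k * h : ℝ) : ℂ) * Complex.I by push_cast; ring,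
      Complex.norm_exp_ofReal_mul_I]
  set z := Complex.exp (Complex.I * k * h) with hzdef
  have hα : (α : ℂ) ≠ 0 := by exact_mod_cast h0.ne'
  have hveq : v = ((t * h ^ (-α) : ℝ) : ℂ) * (1 - z) ^ (α : ℂ) := by
    rw [hv, symbol_zero_eq]
    push_cast
    ring
  -- No branch condition is needed, since the outer exponent is an integer.
  have hpow : (1 - z) ^ ((2 * α : ℝ) : ℂ) = ((1 - z) ^ (α : ℂ)) ^ 2 := by
    rw [← Complex.cpow_nat_mul]
    push_cast
    rfl
  have hhpow : h ^ (-(2 * α)) = (h ^ (-α)) ^ 2 := by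
    rw [← Real.rpow_natCast, ← Real.rpow_mul hh.le]
    congr 1
    push_cast
    ring
  have hv2 : v ^ 2 = -((t : ℂ) ^ 2 * symbol (2 * α) 0 h k) := by
    rw [hveq, symbol_zero_eq, hpow, hhpow]
    push_cast
    ring
  have hintegrand : ∀ x : ℝ, ((t ^ 2 / (4 * x ^ 2) : ℝ) : ℂ) * symbol (2 * α) 0 h k =
      -(v ^ 2 * (1 / (4 * x ^ 2) : ℝ)) := by
    intro x
    rw [hv2]
    push_cast
    ring
  simp only [hintegrand]
  have hrhs : -(t * symbol α 0 h k * Complex.exp (t * symbol α 0 h k)) = v * Complex.exp (-v) := by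
    rw [hv, neg_neg]
    ring
  rw [hrhs]
  -- At `v = 0` the half-plane conditions fail and the real formula is used. Otherwise `z ≠ 1`, so
  -- `1 - z` has positive real part, as do its powers of orders `α` and `2α`, both at most `1`.
  rcases eq_or_ne v 0 with hv0 | hv0
  · simpa [hv0] using integral_subordinator_of_nonneg le_rfl
  · have hz1 : z ≠ 1 := by
      rintro h
      rw [hveq, h, sub_self, Complex.zero_cpow hα, mul_zero] at hv0
      exact hv0 rfl
    have ht0 : 0 < t := by
      refine lt_of_le_of_ne ht fun h => hv0 ?_
      rw [hveq, ← h]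
      simp
    have hre := re_one_sub_pos hz hz1
    have hc : 0 < t * h ^ (-α) := mul_pos ht0 (Real.rpow_pos_of_pos hh _)
    refine integral_subordinator ?_ ?_
    · rw [hveq, Complex.re_ofReal_mul]
      exact mul_pos hc (re_cpow_pos hre h0.le (by linarith))
    · rw [hveq, mul_pow, ← hpow, ← Complex.ofReal_pow, Complex.re_ofReal_mul]
      exact mul_pos (by positivity) (re_cpow_pos hre (by linarith) (by linarith))

/-- Analyticity of the Grünwald semigroups for `α ≤ 1/2`. -/
theorem norm_smul_mul_exp_le_of_le_half (h0 : 0 < α) (h1 : α ≤ 1 / 2) (hh : 0 < h) {t : ℝ}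
    (ht : 0 ≤ t) :
    ‖((t : ℂ) • grunwaldOp α 0 h) * NormedSpace.exp ((t : ℂ) • grunwaldOp α 0 h)‖ ≤
      2 / √Real.pi * ∫ x in Set.Ioi 0, |subordinator x| := by
  have hβ0 : 0 < 2 * α := by linarith
  have hβ1 : 2 * α ≤ 1 := by linarith
  set B := grunwaldOp (2 * α) 0 h with hB
  set F : ℝ → L1R →L[ℂ] L1R := fun x =>
    (subordinator x : ℂ) • NormedSpace.exp (((t ^ 2 / (4 * x ^ 2) : ℝ) : ℂ) • B) with hF
  have hFn : ∀ x, ‖F x‖ ≤ |subordinator x| := fun x => by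
    rw [hF, norm_smul, Complex.norm_real, Real.norm_eq_abs]
    exact mul_le_of_le_one_right (abs_nonneg _)
      (norm_exp_grunwaldOp_zero_le_one hβ0 hβ1 hh (by positivity))
  have hFm : AEStronglyMeasurable F (volume.restrict (Set.Ioi 0)) := by
    refine ContinuousOn.aestronglyMeasurable ?_ measurableSet_Ioi
    have hs : Continuous fun x => (subordinator x : ℂ) := by
      unfold subordinator
      fun_prop
    refine hs.continuousOn.smul ?_
    let _ : NormedAlgebra ℚ (L1R →L[ℂ] L1R) := NormedAlgebra.restrictScalars ℚ ℂ _
    refine NormedSpace.exp_continuous.comp_continuousOn ?_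
    refine ContinuousOn.smul (f := fun x : ℝ => ((t ^ 2 / (4 * x ^ 2) : ℝ) : ℂ)) ?_
      (continuousOn_const (c := B))
    refine Complex.continuous_ofReal.comp_continuousOn ?_
    refine continuousOn_const.div (by fun_prop) fun x hx => ?_
    have : x ≠ 0 := ne_of_gt hx
    positivity
  have hFi : Integrable F (volume.restrict (Set.Ioi 0)) :=
    Integrable.mono' integrableOn_subordinator.abs hFm (Eventually.of_forall hFn)
  -- The scalar `-(2 / √π)` inverts the factor `√π / 2` and the sign in the subordination formula.
  have hsym := (HasSymbol.integral (fun x => (hasSymbol_exp_grunwaldOp hβ0 0 h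
    (t ^ 2 / (4 * x ^ 2))).smul (subordinator x : ℂ)) hFi).smul ((-(2 / √Real.pi) : ℝ) : ℂ)
  have hpi : √Real.pi ≠ 0 := (Real.sqrt_pos.2 Real.pi_pos).ne'
  have heq := (hasSymbol_smul_mul_exp h0 0 h t).unique (hsym.congr fun k => by
    rw [integral_subordinator_symbol h0 h1 hh ht, ← mul_assoc, ← Complex.ofReal_mul,
      show -(2 / √Real.pi) * (√Real.pi / 2) = -1 by field_simp]
    push_cast
    ring)
  rw [heq, norm_smul, Complex.norm_real, norm_neg, Real.norm_of_nonneg (by positivity)]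
  gcongr
  exact norm_integral_le_of_norm_le integrableOn_subordinator.abs (Eventually.of_forall hFn)

/-- Analyticity of the Grünwald semigroups, uniformly in `h`. -/
theorem exists_bound_smul_mul_exp {p : ℕ} (hα : 0 < α) (hp₁ : 2 * (p : ℝ) - 1 < α)
    (hp₂ : α < 2 * (p : ℝ) + 1) :
    ∃ K : ℝ, ∀ h t : ℝ, 0 < h → 0 ≤ t →
      ‖((t : ℂ) • grunwaldOp α p h) * NormedSpace.exp ((t : ℂ) • grunwaldOp α p h)‖ ≤ K := by
  rcases lt_or_ge (1 / 2) α with h | h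
  · obtain ⟨K, hK⟩ := exists_bound_of_half_lt h hp₁ hp₂
    exact ⟨K, fun h t hh ht => (hK h t hh ht).2⟩
  · obtain rfl : p = 0 := by
      have : (p : ℝ) < 1 := by linarith
      exact_mod_cast Nat.lt_one_iff.1 (by exact_mod_cast this)
    exact ⟨_, fun h' t hh ht => norm_smul_mul_exp_le_of_le_half hα h hh ht⟩

/-- Boundedness of the Grünwald semigroups, uniformly in `h` and `t`. -/
theorem exists_bound_exp {p : ℕ} (hα : 0 < α) (hp₁ : 2 * (p : ℝ) - 1 < α)
    (hp₂ : α < 2 * (p : ℝ) + 1) :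
    ∃ K : ℝ, ∀ h t : ℝ, 0 < h → 0 ≤ t →
      ‖NormedSpace.exp ((t : ℂ) • grunwaldOp α p h)‖ ≤ K := by
  rcases lt_or_ge (1 / 2) α with h | h
  · obtain ⟨K, hK⟩ := exists_bound_of_half_lt h hp₁ hp₂
    exact ⟨K, fun h t hh ht => (hK h t hh ht).1⟩
  · obtain rfl : p = 0 := by
      have : (p : ℝ) < 1 := by linarith
      exact_mod_cast Nat.lt_one_iff.1 (by exact_mod_cast this)
    exact ⟨1, fun h' t hh ht => norm_exp_grunwaldOp_zero_le_one hα (by linarith) hh ht⟩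

end

end Grunwald

end

theorem theorem4p3 (α : ℝ) (p : ℕ) (hα : 0 < α) (hp₁ : 2 * (p : ℝ) - 1 < α)
    (hp₂ : α < 2 * (p : ℝ) + 1) :
    -- `ψ_h` and `e^{tψ_h}` are multipliers, and `T_{ψ_h}` generates the strongly continuous
    -- semigroup `{T_{e^{tψ_h}}}`
    (∀ h : ℝ, 0 < h →
      Grunwald.IsL1Multiplier (Grunwald.symbol α p h) ∧
      (∀ t : ℝ, 0 ≤ t →
        Grunwald.IsL1Multiplier fun k => Complex.exp (t * Grunwald.symbol α p h k)) ∧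
      Grunwald.IsC0Semigroup (Grunwald.semigroup α p h) ∧
      Grunwald.IsBoundedGenerator (Grunwald.multiplierOp (Grunwald.symbol α p h))
        (Grunwald.semigroup α p h)) ∧
    -- uniform boundedness in `h` and `t`
    (∃ K : ℝ, ∀ h t : ℝ, 0 < h → 0 ≤ t → ‖Grunwald.semigroup α p h t‖ ≤ K) ∧
    -- positive contractions on `L₁(ℝ)` for `1 < α < 2`
    (1 < α → α < 2 → ∀ h t : ℝ, 0 < h → 0 ≤ t →
      Grunwald.IsPositiveOp (Grunwald.semigroup α p h t) ∧
      ‖Grunwald.semigroup α p h t‖ ≤ 1) ∧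
    -- for `0 < α < 1`, a positive contraction semigroup on `L₁(ℝ₊)`
    (α < 1 → ∀ h : ℝ, 0 < h → ∃ S : ℝ → Grunwald.L1Plus →L[ℂ] Grunwald.L1Plus,
      (∀ t : ℝ, 0 ≤ t → ∀ f : Grunwald.L1Plus,
        Grunwald.extendByZero (S t f) =
          Grunwald.semigroup α p h t (Grunwald.extendByZero f)) ∧
      Grunwald.IsC0Semigroup S ∧
      ∀ t : ℝ, 0 ≤ t → Grunwald.IsPositiveOp (S t) ∧ ‖S t‖ ≤ 1) ∧
    -- uniform analyticity
    (∃ M : ℝ, 0 < M ∧ ∀ h t : ℝ, 0 < h → 0 < t →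
      (Grunwald.IsL1Multiplier fun k =>
        Grunwald.symbol α p h k * Complex.exp (t * Grunwald.symbol α p h k)) ∧
      ‖Grunwald.multiplierOp fun k =>
        Grunwald.symbol α p h k * Complex.exp (t * Grunwald.symbol α p h k)‖ ≤ M / t) := by
  have hsg := fun h => Grunwald.semigroup_eq_exp hα p h
  refine ⟨fun h _ => ⟨?_, fun t _ => ?_, ?_, ?_⟩, ?_, fun h1 h2 h t hh ht => ?_,
    fun h1 h hh => ?_, ?_⟩
  · exact (Grunwald.hasSymbol_grunwaldOp hα p h).isL1Multiplier (Grunwald.measurable_symbol α p h)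
  · exact (Grunwald.hasSymbol_exp_grunwaldOp hα p h t).isL1Multiplier
      (Grunwald.measurable_exp_symbol α p h t)
  · rw [hsg]
    exact Grunwald.isC0Semigroup_exp _
  · rw [hsg, Grunwald.multiplierOp_symbol hα]
    exact Grunwald.isBoundedGenerator_exp _
  · simp only [hsg]
    exact Grunwald.exists_bound_exp hα hp₁ hp₂
  · obtain rfl : p = 1 := by
      have h3 : p < 2 := by exact_mod_cast (by linarith : (p : ℝ) < 2)
      have h4 : 0 < p := by exact_mod_cast (by linarith : (0 : ℝ) < p)
      lia
    have hc : ∀ m, m ≠ 1 → 0 ≤ Grunwald.grunwaldCoeff α 1 h m := fun m hm =>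
      Grunwald.grunwaldCoeff_nonneg_of_one_lt h1 h2 hh hm
    simp only [hsg]
    exact ⟨Grunwald.isPositiveOp_exp_grunwaldOp hα hc ht,
      Grunwald.norm_exp_grunwaldOp_le_one hα hc ht⟩
  · obtain rfl : p = 0 := by
      have h3 : p < 1 := by exact_mod_cast (by linarith : (p : ℝ) < 1)
      lia
    exact Grunwald.exists_halfLine_semigroup hα h1.le hh
  · obtain ⟨K, hK⟩ := Grunwald.exists_bound_smul_mul_exp hα hp₁ hp₂
    refine ⟨max K 1, lt_max_of_lt_right one_pos, fun h t hh ht => ?_⟩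
    have hs := (Grunwald.hasSymbol_grunwaldOp hα p h).mul
      (Grunwald.hasSymbol_exp_grunwaldOp hα p h t)
    have hm := (Grunwald.measurable_symbol α p h).mul (Grunwald.measurable_exp_symbol α p h t)
    refine ⟨hs.isL1Multiplier hm, ?_⟩
    rw [hs.multiplierOp_eq hm, le_div_iff₀ ht]
    have h1 := hK h t hh ht.le
    rw [smul_mul_assoc, norm_smul, Complex.norm_real, Real.norm_of_nonneg ht.le, mul_comm] at h1
    exact h1.trans (le_max_left _ _)
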